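/- A \emph{pre-orthogeometry} $\mathcal G=(P,L)$ is a set $P$ of points and a set $L$ of lines, where each line is a set of exactly $3$ points and any two distinct points lie on at most one line. It is \emph{proper} if every point lies on some line. A \emph{subspace} is a set $S\subseteq P$ that contains every line having at least two points in $S$. A \emph{plane} is a subspace consisting of $7$ distinct points $a,b,c,d,x,y,z$ such that the lines containing at least two of these points are exactly the six lines $\{a,b,x\},\{a,c,y\},\{b,c,z\},\{c,d,x\},\{b,d,y\},\{a,d,z\}$ (the sides and medians of a triangle $abc$ with centre $d$ and midpoints $x,y,z$). A \emph{non-degenerate triangle} consists of three distinct points, any two of which lie on a line, that do not all lie on one line. A \emph{direction} for a point $p$ assigns $\uparrow$ or $\downarrow$ to each line through $p$ such that two lines $\ell,m$ through $p$ receive opposite values if and only if there is a plane containing $\ell$ and $m$ in which $\ell,m$ are the only lines through $p$. An \emph{orthomodular poset} is a bounded poset $A$ with an orthocomplementation $'$ (an order-reversing involution with $a\wedge a'=0$ and $a\vee a'=1$) in which any $a,b$ with $a\le b'$ have a join, and in which $a\le b$ implies $b=a\vee(b\wedge a')$. A \emph{Boolean subalgebra} of $A$ is a subset containing $0,1$,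 closed under $'$ and under joins of orthogonal elements, that is a Boolean algebra in the induced order. An \emph{orthogeometry} is a pre-orthogeometry that, for some orthomodular poset $A$, is isomorphic to the geometry whose points are the $4$-element Boolean subalgebras of $A$ and whose lines are the $8$-element Boolean subalgebras of $A$, each regarded as the set of $4$-element Boolean subalgebras it contains; an isomorphism is a bijection of points under which lines correspond exactly to lines. \textbf{Theorem.} A proper pre-orthogeometry $\mathcal G=(P,L)$ is an orthogeometry if and only if the following two conditions hold: \begin{enumerate} \item every non-degenerate triangle is contained in a subspace that is a plane; \item every point has a direction. \end{enumerate} -/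

import Mathlib

universe u

/-- An orthomodular poset: a bounded poset with an orthocomplementation `ᶜ` in which any two
orthogonal elements (`a ≤ bᶜ`) have a join and which satisfies the orthomodular law
`a ≤ b → b = a ∨ (b ∧ aᶜ)`.  The meet `b ∧ aᶜ = (bᶜ ∨ a)ᶜ` always exists, because `a ≤ b = bᶜᶜ`. -/
class OrthomodularPoset (A : Type u) extends PartialOrder A, BoundedOrder A, Compl A where
  compl_compl' : ∀ a : A, aᶜᶜ = a
  compl_anti' : ∀ a b : A, a ≤ b → bᶜ ≤ aᶜ
  isCompl_compl' : ∀ a : A, IsCompl a aᶜ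
  exists_isLUB' : ∀ a b : A, a ≤ bᶜ → ∃ c : A, IsLUB {a, b} c
  orthomodular' : ∀ a b c : A, a ≤ b → IsGLB {b, aᶜ} c → IsLUB {a, c} b

/-- A Boolean subalgebra of an orthomodular poset: a subset containing `⊥` and `⊤`, closed under
orthocomplements and under joins of orthogonal elements, which is a Boolean algebra in the induced
order.  (The orthocomplement of `A` is then automatically the complement of that Boolean algebra,
because complements in a Boolean algebra are unique.) -/
structure IsBooleanSubalgebra {A : Type u} [OrthomodularPoset A] (S : Set A) : Prop where
  bot_mem : ⊥ ∈ S
  top_mem : ⊤ ∈ S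
  compl_mem : ∀ a ∈ S, aᶜ ∈ S
  join_mem : ∀ a ∈ S, ∀ b ∈ S, a ≤ bᶜ → ∀ c, IsLUB {a, b} c → c ∈ S
  boolean : ∃ (B : Type u) (_ : BooleanAlgebra B), Nonempty (S ≃o B)

/-- A set `P` of points together with a set of lines, each line being a set of points. -/
structure PointLineGeometry (P : Type u) where
  lines : Set (Set P)

/-- An isomorphism of point-line geometries: a bijection between the points under which the lines
of the first geometry correspond exactly to the lines of the second. -/
structure PointLineGeometry.Iso {P Q : Type u} (G : PointLineGeometry P)
    (H : PointLineGeometry Q) where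
  toEquiv : P ≃ Q
  mem_lines_iff : ∀ s : Set P, s ∈ G.lines ↔ toEquiv '' s ∈ H.lines

/-- A pre-orthogeometry: every line has exactly three points, and any two (distinct) points are
contained in at most one line. -/
structure PreOrthogeometry (P : Type u) extends PointLineGeometry P where
  ncard_line : ∀ l ∈ lines, l.ncard = 3
  line_unique : ∀ p q : P, p ≠ q → ∀ l ∈ lines, ∀ m ∈ lines,
    p ∈ l → q ∈ l → p ∈ m → q ∈ m → l = m

/-- The points of the geometry of `A`: the 4-element Boolean subalgebras. -/
def OrthomodularPoset.Point (A : Type u) [OrthomodularPoset A] : Type u :=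
  {S : Set A // IsBooleanSubalgebra S ∧ S.ncard = 4}

/-- The points and lines of the hypergraph of an orthomodular poset `A`.  The points are the
4-element Boolean subalgebras, and every 8-element Boolean subalgebra `T` is regarded as a line,
namely as the set of all points contained in `T`. -/
def OrthomodularPoset.geometry (A : Type u) [OrthomodularPoset A] :
    PointLineGeometry (OrthomodularPoset.Point A) where
  lines := {l | ∃ T : Set A, IsBooleanSubalgebra T ∧ T.ncard = 8 ∧
    l = {p : OrthomodularPoset.Point A | p.1 ⊆ T}}

/-- The two possible values of a direction on a line. -/
inductive Arrow : Type
  | up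
  | down

namespace PreOrthogeometry

variable {P : Type u} (G : PreOrthogeometry P)

/-- An orthogeometry is a pre-orthogeometry that is isomorphic to the geometry of 4-element and
8-element Boolean subalgebras of some orthomodular poset. -/
def IsOrthogeometry : Prop :=
  ∃ (A : Type u) (_ : OrthomodularPoset A),
    Nonempty (G.toPointLineGeometry.Iso (OrthomodularPoset.geometry A))

/-- Every point lies on some line. -/
def IsProper : Prop := ∀ p : P, ∃ l ∈ G.lines, p ∈ l

/-- If two points of a line belong to `S`, then the whole line is contained in `S`. -/
def IsSubspace (S : Set P) : Prop := ∀ l ∈ G.lines, (l ∩ S).Nontrivial → l ⊆ S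

/-- A plane: a subspace consisting of seven points such that the lines containing at least two of
these points are exactly the three sides of a triangle `a b c` and its three medians.  Here `d` is
the centre, and `x`, `y`, `z` are the midpoints of the sides `ab`, `ac`, `bc`. -/
def IsPlane (w : Set P) : Prop :=
  G.IsSubspace w ∧ ∃ a b c d x y z : P, [a, b, c, d, x, y, z].Nodup ∧
    w = {a, b, c, d, x, y, z} ∧
    {l | l ∈ G.lines ∧ (l ∩ w).Nontrivial} =
      {{a, b, x}, {a, c, y}, {b, c, z}, {c, d, x}, {b, d, y}, {a, d, z}}

/-- Three distinct points, any two of which belong to a line, that do not all lie on one line. -/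
def IsNondegenerateTriangle (p q r : P) : Prop :=
  p ≠ q ∧ p ≠ r ∧ q ≠ r ∧
  (∃ l ∈ G.lines, p ∈ l ∧ q ∈ l) ∧ (∃ l ∈ G.lines, p ∈ l ∧ r ∈ l) ∧
  (∃ l ∈ G.lines, q ∈ l ∧ r ∈ l) ∧ ¬ ∃ l ∈ G.lines, p ∈ l ∧ q ∈ l ∧ r ∈ l

/-- A direction for `p` assigns an arrow to each line through `p`, in such a way that two lines
obtain opposite arrows iff they lie in a plane in which they are the only lines through `p`. -/
structure Direction (p : P) where
  arrow : {l : Set P // l ∈ G.lines ∧ p ∈ l} → Arrow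
  opposite_iff : ∀ l m : {l : Set P // l ∈ G.lines ∧ p ∈ l},
    arrow l ≠ arrow m ↔
      ∃ w : Set P, G.IsPlane w ∧ {n | n ∈ G.lines ∧ n ⊆ w ∧ p ∈ n} = {l.1, m.1}

end PreOrthogeometry

/-! A point of the geometry of an orthomodular poset is a pair {a, aᶜ} of proper elements, and a
line is a triad: three nonzero pairwise orthogonal elements, each the complement of the join of the
other two. A line therefore selects, at each of its points, the element of the pair that is an atom
of the line, and this selection is the direction.

Necessity. If u is an atom of one line and uᶜ of another, with remaining atoms a, b and c, d, then
a, b, c, d behave like the atoms of a 16-element Boolean algebra (`Triad.exists_chain`). They are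
the vertices of a plane; its midpoints are the three splittings of the atoms into two pairs, and {u,
uᶜ} is one of them. Conversely, comparing elements shows that the two lines through a midpoint never
select the same element (`not_isUp_of_isQuad`). A non-degenerate triangle yields, up to complements,
either three pairwise orthogonal elements or a chain b ≤ a ≤ cᶜ, and both extend to such a
configuration (`exists_isPlane_of_triangle`).

Sufficiency. The directions put a sign on each flag. Take two signed copies of every point together
with bounds, and let the copy selected by a line at one of its points lie below the complement of
the copy selected at another. Transitivity holds because opposite signs at the middle point make it
a midpoint of a plane, whose sides join the outer points (`exists_line_trans`). Joins exist because
a triangle whose signs agree at each corner consists of three vertices of a plane, and a median then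
supplies the required inequality (`exists_line_join`). Orthomodularity reflects the symmetry of a
line in its three points. -/

namespace OrthomodularPoset

/-! ### Orthogonality and triads in an orthomodular poset. -/

variable {A : Type u} [OrthomodularPoset A] {a b c d x : A}

theorem compl_compl (a : A) : aᶜᶜ = a := compl_compl' a

theorem le_compl_comm : a ≤ bᶜ ↔ b ≤ aᶜ :=
  ⟨fun h => compl_compl b ▸ compl_anti' _ _ h, fun h => compl_compl a ▸ compl_anti' _ _ h⟩

theorem compl_le_compl : aᶜ ≤ bᶜ ↔ b ≤ a := by
  rw [le_compl_comm, compl_compl]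

theorem compl_bot : (⊥ : A)ᶜ = ⊤ :=
  top_unique (le_compl_comm.1 bot_le)

theorem compl_top : (⊤ : A)ᶜ = ⊥ := by
  rw [← compl_bot, compl_compl]

theorem eq_bot_of_le (h : x ≤ a) (h' : x ≤ aᶜ) : x = ⊥ :=
  le_bot_iff.1 ((isCompl_compl' a).disjoint h h')

theorem eq_top_of_le (h : a ≤ x) (h' : aᶜ ≤ x) : x = ⊤ :=
  top_le_iff.1 ((isCompl_compl' a).codisjoint h h')

theorem isLUB_compl (a : A) : IsLUB {a, aᶜ} (⊤ : A) := by
  refine ⟨fun _ _ => le_top, fun x hx => ?_⟩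
  rw [eq_top_of_le (hx (Set.mem_insert _ _)) (hx (Set.mem_insert_of_mem _ rfl))]

theorem isLUB_bot_left (a : A) : IsLUB {⊥, a} a :=
  ⟨by simp [upperBounds], fun _ hx => hx (by simp)⟩

theorem isLUB_bot_right (a : A) : IsLUB {a, ⊥} a :=
  Set.pair_comm ⊥ a ▸ isLUB_bot_left a

/-- Three nonzero pairwise orthogonal elements whose join is `⊤`: the atoms of an 8-element
Boolean subalgebra. -/
structure Triad (a b c : A) : Prop where
  left_ne : a ≠ ⊥
  mid_ne : b ≠ ⊥
  right_ne : c ≠ ⊥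
  orth : a ≤ bᶜ
  lub : IsLUB {a, b} cᶜ

namespace Triad

theorem swap (h : Triad a b c) : Triad b a c :=
  ⟨h.mid_ne, h.left_ne, h.right_ne, le_compl_comm.1 h.orth, by rw [Set.pair_comm]; exact h.lub⟩

theorem left_le (h : Triad a b c) : a ≤ cᶜ := h.lub.1 (Set.mem_insert _ _)

theorem mid_le (h : Triad a b c) : b ≤ cᶜ := h.lub.1 (Set.mem_insert_of_mem _ rfl)

theorem compl_le (h : Triad a b c) (ha : a ≤ x) (hb : b ≤ x) : cᶜ ≤ x :=
  h.lub.2 (by rintro y (rfl | rfl) <;> assumption)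

/-- Since c is the meet of aᶜ and bᶜ, the orthomodular law for b ≤ aᶜ reads aᶜ = b ∨ c. With `swap`
this makes the notion symmetric in all three elements. -/
theorem rot (h : Triad a b c) : Triad b c a := by
  refine ⟨h.mid_ne, h.right_ne, h.left_ne, h.mid_le, ?_⟩
  refine orthomodular' b aᶜ c (le_compl_comm.1 h.orth) ⟨?_, ?_⟩
  · rintro y (rfl | rfl)
    · exact le_compl_comm.1 h.left_le
    · exact le_compl_comm.1 h.mid_le
  · intro y hy
    have h1 : y ≤ aᶜ := hy (Set.mem_insert _ _)
    have h2 : y ≤ bᶜ := hy (Set.mem_insert_of_mem _ rfl)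
    have := h.compl_le (le_compl_comm.1 h1) (le_compl_comm.1 h2)
    exact compl_le_compl.1 this

theorem le_of_le (h : Triad a b c) (ha : x ≤ aᶜ) (hb : x ≤ bᶜ) : x ≤ c :=
  compl_le_compl.1 (h.compl_le (le_compl_comm.1 ha) (le_compl_comm.1 hb))

theorem left_ne_top (h : Triad a b c) : a ≠ ⊤ := by
  rintro rfl
  exact h.mid_ne (le_bot_iff.1 (compl_top (A := A) ▸ le_compl_comm.1 h.orth))

end Triad

/-- The third element is the complement of a ∨ b. It is nonzero: if a ∨ b = ⊤ then bᶜ ∧ aᶜ = ⊥, and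
the orthomodular law for a ≤ bᶜ gives a = bᶜ. -/
theorem exists_triad (ha : a ≠ ⊥) (hb : b ≠ ⊥) (h : a ≤ bᶜ) (hne : a ≠ bᶜ) :
    ∃ c, Triad a b c := by
  obtain ⟨c, hc⟩ := exists_isLUB' a b h
  refine ⟨cᶜ, ha, hb, ?_, h, by rwa [compl_compl]⟩
  intro h0
  have hc1 : c = ⊤ := by rw [← compl_compl c, h0, compl_bot]
  subst hc1
  refine hne (le_antisymm h ?_)
  have := orthomodular' a bᶜ ⊥ h ⟨fun _ _ => bot_le, fun y hy => ?_⟩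
  · exact this.2 (by rintro y (rfl | rfl); exacts [le_rfl, bot_le])
  · have h1 : y ≤ bᶜ := hy (Set.mem_insert _ _)
    have h2 : y ≤ aᶜ := hy (Set.mem_insert_of_mem _ rfl)
    have : ⊤ ≤ yᶜ := hc.2 (by
      rintro z (rfl | rfl)
      exacts [le_compl_comm.1 h2, le_compl_comm.1 h1])
    rw [le_compl_comm, compl_top] at this
    exact this

/-! ### Boolean subalgebras with 4 and 8 elements. -/

section BooleanSubalgebra

variable {B : Type*} [BooleanAlgebra B]

/-- Order is reflected because f s ≤ f t puts f (s \ t) below both f t and its complement, so s \ t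
= ⊥. The copy `C` only serves to place the Boolean algebra in the universe of `A`. -/
theorem isBooleanSubalgebra_range (C : Type u) [BooleanAlgebra C] (e : B ≃o C) (f : B → A)
    (hbot : f ⊥ = ⊥) (hcompl : ∀ s, f sᶜ = (f s)ᶜ)
    (hsup : ∀ s t, Disjoint s t → IsLUB {f s, f t} (f (s ⊔ t)))
    (hinj : ∀ s, f s = ⊥ → s = ⊥) :
    IsBooleanSubalgebra (Set.range f) ∧ Function.Injective f := by
  have hmono : ∀ s t, s ≤ t → f s ≤ f t := fun s t h => by
    have := (hsup s (t \ s) disjoint_sdiff_self_right).1 (Set.mem_insert _ _)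
    rwa [sup_sdiff_cancel_right h] at this
  have hle : ∀ s t, f s ≤ f t ↔ s ≤ t := fun s t => by
    refine ⟨fun h => sdiff_eq_bot_iff.1 (hinj _ (eq_bot_of_le (a := f t) ?_ ?_)), hmono s t⟩
    · exact (hmono _ _ sdiff_le).trans h
    · rw [← hcompl, sdiff_eq]
      exact hmono _ _ inf_le_right
  have hf : Function.Injective f := fun s t h =>
    le_antisymm ((hle _ _).1 h.le) ((hle _ _).1 h.ge)
  refine ⟨⟨⟨⊥, hbot⟩, ⟨⊤, ?_⟩, ?_, ?_, C, inferInstance, ⟨?_⟩⟩, hf⟩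
  · rw [← _root_.compl_bot, hcompl, hbot, compl_bot]
  · rintro _ ⟨s, rfl⟩
    exact ⟨sᶜ, hcompl s⟩
  · rintro _ ⟨s, rfl⟩ _ ⟨t, rfl⟩ h c hc
    rw [← hcompl, hle, le_compl_iff_disjoint_right] at h
    exact ⟨s ⊔ t, (hsup s t h).unique hc⟩
  · exact OrderIso.trans (OrderEmbedding.orderIso (f := OrderEmbedding.ofMapLEIff f hle)).symm e

/-- The Boolean algebra `Fin n → Bool`, lifted to an arbitrary universe. -/
def boolCubeLift (n : ℕ) : (Fin n → Bool) ≃o (ULift.{u} (Fin n) → Bool) where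
  toEquiv := Equiv.arrowCongr Equiv.ulift.symm (Equiv.refl _)
  map_rel_iff' := by
    intro s t
    exact ⟨fun h i => h ⟨i⟩, fun h i => h i.down⟩

/-- The elements of the 4-element Boolean subalgebra generated by `a`. -/
def fourSet (a : A) : Set A := {⊥, ⊤, a, aᶜ}

/-- The elements of the 8-element Boolean subalgebra with atoms `a`, `b`, `c`. -/
def eightSet (a b c : A) : Set A := {⊥, ⊤, a, b, c, aᶜ, bᶜ, cᶜ}

theorem isBooleanSubalgebra_fourSet (ha : a ≠ ⊥) (ha' : a ≠ ⊤) :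
    IsBooleanSubalgebra (fourSet a) ∧ (fourSet a).ncard = 4 := by
  -- Coordinate 0 records whether a lies below the element, coordinate 1 whether aᶜ does.
  let f : (Fin 2 → Bool) → A := fun s => match s 0, s 1 with
    | false, false => ⊥
    | true, false => a
    | false, true => aᶜ
    | true, true => ⊤
  have hca : aᶜ ≠ ⊥ := fun h => ha' (by rw [← compl_compl a, h, compl_bot])
  have key := isBooleanSubalgebra_range (ULift.{u} (Fin 2) → Bool) (boolCubeLift 2) f rfl
    (by
      intro s
      simp only [f, Pi.compl_apply]
      cases s 0 <;> cases s 1 <;> simp [compl_compl, compl_bot, compl_top])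
    (by
      intro s t hst
      rw [Pi.disjoint_iff] at hst
      have h0 := hst 0
      have h1 := hst 1
      simp only [f, Pi.sup_apply]
      have la := isLUB_compl a
      have la' := Set.pair_comm a aᶜ ▸ isLUB_compl a
      rw [disjoint_iff] at h0 h1
      clear hst
      generalize s 0 = s0 at *
      generalize s 1 = s1 at *
      generalize t 0 = t0 at *
      generalize t 1 = t1 at *
      cases s0 <;> cases t0 <;> first | exact absurd h0 (by decide) | skip
      all_goals cases s1 <;> cases t1 <;> first | exact absurd h1 (by decide) | skip
      all_goals first | exact isLUB_bot_left _ | exact isLUB_bot_right _ | assumption)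
    (by
      intro s hs
      have : (⊤ : A) ≠ ⊥ := fun h => ha (le_bot_iff.1 (h ▸ le_top))
      ext i
      simp only [f] at hs
      cases h0 : s 0 <;> cases h1 : s 1 <;> fin_cases i <;> simp_all)
  have hr : Set.range f = fourSet a := by
    ext y
    simp only [Set.mem_range, fourSet, Set.mem_insert_iff, Set.mem_singleton_iff]
    constructor
    · rintro ⟨s, rfl⟩
      simp only [f]
      cases s 0 <;> cases s 1 <;> simp
    · rintro (rfl | rfl | rfl | rfl)
      exacts [⟨![false, false], rfl⟩, ⟨![true, true], rfl⟩, ⟨![true, false], rfl⟩,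
        ⟨![false, true], rfl⟩]
  rw [← hr]
  refine ⟨key.1, ?_⟩
  rw [← Set.image_univ, Set.ncard_image_of_injective _ key.2, Set.ncard_univ]
  simp

theorem isBooleanSubalgebra_eightSet (h : Triad a b c) :
    IsBooleanSubalgebra (eightSet a b c) ∧ (eightSet a b c).ncard = 8 := by
  -- The three coordinates record which of a, b, c lie below the element.
  let f : (Fin 3 → Bool) → A := fun s => match s 0, s 1, s 2 with
    | false, false, false => ⊥
    | true, false, false => a
    | false, true, false => b
    | false, false, true => c
    | false, true, true => aᶜ
    | true, false, true => bᶜ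
    | true, true, false => cᶜ
    | true, true, true => ⊤
  have ha := h.left_ne
  have hb := h.mid_ne
  have hc := h.right_ne
  have hca : aᶜ ≠ ⊥ := fun h1 => h.left_ne_top (by rw [← compl_compl a, h1, compl_bot])
  have hcb : bᶜ ≠ ⊥ := fun h1 => h.rot.left_ne_top (by rw [← compl_compl b, h1, compl_bot])
  have hcc : cᶜ ≠ ⊥ := fun h1 => h.rot.rot.left_ne_top (by rw [← compl_compl c, h1, compl_bot])
  have key := isBooleanSubalgebra_range (ULift.{u} (Fin 3) → Bool) (boolCubeLift 3) f rfl
    (by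
      intro s
      simp only [f, Pi.compl_apply]
      cases s 0 <;> cases s 1 <;> cases s 2 <;> simp [compl_compl, compl_bot, compl_top])
    (by
      intro s t hst
      rw [Pi.disjoint_iff] at hst
      have h0 := hst 0
      have h1 := hst 1
      have h2 := hst 2
      simp only [f, Pi.sup_apply]
      have la := isLUB_compl a
      have lb := isLUB_compl b
      have lc := isLUB_compl c
      have la' := Set.pair_comm a aᶜ ▸ isLUB_compl a
      have lb' := Set.pair_comm b bᶜ ▸ isLUB_compl b
      have lc' := Set.pair_comm c cᶜ ▸ isLUB_compl c
      have l1 := h.lub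
      have l2 := h.rot.lub
      have l3 := h.rot.rot.lub
      have l4 := h.swap.lub
      have l5 := h.rot.swap.lub
      have l6 := h.rot.rot.swap.lub
      rw [disjoint_iff] at h0 h1 h2
      clear hst
      generalize s 0 = s0 at *
      generalize s 1 = s1 at *
      generalize s 2 = s2 at *
      generalize t 0 = t0 at *
      generalize t 1 = t1 at *
      generalize t 2 = t2 at *
      cases s0 <;> cases t0 <;> first | exact absurd h0 (by decide) | skip
      all_goals cases s1 <;> cases t1 <;> first | exact absurd h1 (by decide) | skip
      all_goals cases s2 <;> cases t2 <;> first | exact absurd h2 (by decide) | skip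
      all_goals first | exact isLUB_bot_left _ | exact isLUB_bot_right _ | assumption)
    (by
      intro s hs
      have : (⊤ : A) ≠ ⊥ := fun h => ha (le_bot_iff.1 (h ▸ le_top))
      ext i
      simp only [f] at hs
      cases h0 : s 0 <;> cases h1 : s 1 <;> cases h2 : s 2 <;> fin_cases i <;> simp_all)
  have hr : Set.range f = eightSet a b c := by
    ext y
    simp only [Set.mem_range, eightSet, Set.mem_insert_iff, Set.mem_singleton_iff]
    constructor
    · rintro ⟨s, rfl⟩
      simp only [f]
      cases s 0 <;> cases s 1 <;> cases s 2 <;> simp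
    · rintro (rfl | rfl | rfl | rfl | rfl | rfl | rfl | rfl)
      exacts [⟨![false, false, false], rfl⟩, ⟨![true, true, true], rfl⟩,
        ⟨![true, false, false], rfl⟩, ⟨![false, true, false], rfl⟩,
        ⟨![false, false, true], rfl⟩, ⟨![false, true, true], rfl⟩,
        ⟨![true, false, true], rfl⟩, ⟨![true, true, false], rfl⟩]
  rw [← hr]
  refine ⟨key.1, ?_⟩
  rw [← Set.image_univ, Set.ncard_image_of_injective _ key.2, Set.ncard_univ]
  simp

theorem fourSet_subset {S : Set A} (hS : IsBooleanSubalgebra S) (ha : a ∈ S) : fourSet a ⊆ S := by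
  rintro y (rfl | rfl | rfl | rfl)
  exacts [hS.bot_mem, hS.top_mem, ha, hS.compl_mem _ ha]

theorem exists_eq_fourSet {S : Set A} (hS : IsBooleanSubalgebra S) (h4 : S.ncard = 4) :
    ∃ a, a ≠ ⊥ ∧ a ≠ ⊤ ∧ S = fourSet a := by
  have hfin : S.Finite := Set.finite_of_ncard_ne_zero (by omega)
  obtain ⟨a, haS, ha⟩ : ∃ a ∈ S, a ∉ ({⊥, ⊤} : Set A) :=
    Set.exists_mem_notMem_of_ncard_lt_ncard (by
      have := Set.ncard_insert_le (⊥ : A) {⊤}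
      rw [Set.ncard_singleton] at this
      omega)
  simp only [Set.mem_insert_iff, Set.mem_singleton_iff, not_or] at ha
  refine ⟨a, ha.1, ha.2, ?_⟩
  exact (Set.eq_of_subset_of_ncard_le (fourSet_subset hS haS)
    (by rw [h4, (isBooleanSubalgebra_fourSet ha.1 ha.2).2]) hfin).symm

/-- A finite Boolean algebra is the power set of its set of atoms, and 2 ^ n = 8 forces three atoms.
Their images form the triad, once complements and orthogonal joins in `T` are known to be those of
`A`. -/
theorem exists_eq_eightSet {T : Set A} (hT : IsBooleanSubalgebra T) (h8 : T.ncard = 8) :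
    ∃ a b c, Triad a b c ∧ T = eightSet a b c := by
  classical
  obtain ⟨B, _, ⟨e⟩⟩ := hT.boolean
  have hfin : T.Finite := Set.finite_of_ncard_ne_zero (by omega)
  have : Finite T := hfin
  have : Finite B := Finite.of_equiv T e.toEquiv
  let _ : Fintype B := Fintype.ofFinite B
  let _ := Fintype.toCompleteAtomicBooleanAlgebra B
  let X := {b : B // IsAtom b}
  let g : T ≃o Set X := e.trans CompleteAtomicBooleanAlgebra.toSetOfIsAtom
  have hc : Nat.card (Set X) = 8 := by
    rw [← Nat.card_congr g.toEquiv, Nat.card_coe_set_eq, h8]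
  let _ : Fintype X := Fintype.ofFinite X
  rw [Nat.card_eq_fintype_card, Fintype.card_set] at hc
  have h3 : Fintype.card X = 3 := Nat.pow_right_injective le_rfl (hc.trans (by norm_num : 8 = 2 ^ 3))
  obtain ⟨i, j, k, hij, hik, hjk, hX⟩ := Finset.card_eq_three.1 (h3 : (Finset.univ : Finset X).card = 3)
  have hX' : ∀ l : X, l = i ∨ l = j ∨ l = k := fun l => by
    have := Finset.mem_univ l
    rw [hX] at this
    simpa using this
  let h := g.symm
  let bT : T := ⟨⊥, hT.bot_mem⟩
  let tT : T := ⟨⊤, hT.top_mem⟩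
  have hbot : (h ∅ : A) = ⊥ := le_bot_iff.1 (by
    have : h ∅ ≤ bT := (g.symm_apply_le).2 (Set.empty_subset _)
    exact this)
  have htop : (h Set.univ : A) = ⊤ := top_le_iff.1 (by
    have : tT ≤ h Set.univ := (g.le_symm_apply).2 (Set.subset_univ _)
    exact this)
  -- The orthocomplement is a lattice complement inside `T`, and complements in a power set are
  -- unique.
  have hcompl : ∀ U, (h Uᶜ : A) = (h U : A)ᶜ := fun U => by
    let y : T := ⟨(h U : A)ᶜ, hT.compl_mem _ (h U).2⟩
    have hy : g y = Uᶜ := by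
      refine (IsCompl.compl_eq (a := U) ⟨?_, ?_⟩).symm
      · intro V h1 h2
        have h1' : h V ≤ h U := h.monotone h1
        have h2' : h V ≤ y := g.symm_apply_le.2 h2
        have h0 : (h V : A) = ⊥ := eq_bot_of_le (a := (h U : A)) h1' h2'
        have : h V = h ∅ := Subtype.ext (h0.trans hbot.symm)
        rw [h.injective this]
        exact bot_le
      · intro V h1 h2
        have h1' : h U ≤ h V := h.monotone h1
        have h2' : y ≤ h V := g.le_symm_apply.2 h2
        have h0 : (h V : A) = ⊤ := eq_top_of_le (a := (h U : A)) h1' h2'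
        have : h V = h Set.univ := Subtype.ext (h0.trans htop.symm)
        rw [h.injective this]
        exact le_top
    have : h Uᶜ = y := by rw [← hy]; exact g.symm_apply_apply y
    rw [this]
  have hne : ∀ l : X, (h {l} : A) ≠ ⊥ := fun l h0 => by
    have : h {l} = h ∅ := Subtype.ext (h0.trans hbot.symm)
    exact (Set.singleton_ne_empty l) (h.injective this)
  have horth : (h {i} : A) ≤ (h {j} : A)ᶜ := by
    rw [← hcompl]
    exact h.monotone (by simpa using hij.symm)
  -- The join taken in `A` lies in `T` by `join_mem`, so it can be compared with hₖᶜ through the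
  -- power set.
  have hlub : IsLUB {(h {i} : A), (h {j} : A)} (h {k} : A)ᶜ := by
    obtain ⟨y, hy⟩ := exists_isLUB' _ _ horth
    have hyT := hT.join_mem _ (h {i}).2 _ (h {j}).2 horth y hy
    have hle : y ≤ (h {k} : A)ᶜ := hy.2 (by
      rintro z (rfl | rfl) <;> rw [← hcompl] <;> refine h.monotone ?_
      exacts [by simpa using hik.symm, by simpa using hjk.symm])
    have hge : (h {k} : A)ᶜ ≤ y := by
      rw [← hcompl]
      have : h {k}ᶜ ≤ ⟨y, hyT⟩ := g.symm_apply_le.2 (by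
        intro l hl
        have h1 : h {i} ≤ ⟨y, hyT⟩ := hy.1 (Set.mem_insert _ _)
        have h2 : h {j} ≤ ⟨y, hyT⟩ := hy.1 (Set.mem_insert_of_mem _ rfl)
        rcases hX' l with rfl | rfl | rfl
        · exact g.symm_apply_le.1 h1 rfl
        · exact g.symm_apply_le.1 h2 rfl
        · exact absurd rfl hl)
      exact this
    rwa [le_antisymm hge hle]
  have htri : Triad (h {i} : A) (h {j}) (h {k}) := ⟨hne i, hne j, hne k, horth, hlub⟩
  refine ⟨_, _, _, htri, (Set.eq_of_subset_of_ncard_le ?_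
    (by rw [h8, (isBooleanSubalgebra_eightSet htri).2]) hfin).symm⟩
  rintro y (rfl | rfl | rfl | rfl | rfl | rfl | rfl | rfl)
  exacts [hT.bot_mem, hT.top_mem, (h {i}).2, (h {j}).2, (h {k}).2, hT.compl_mem _ (h {i}).2,
    hT.compl_mem _ (h {j}).2, hT.compl_mem _ (h {k}).2]

end BooleanSubalgebra

end OrthomodularPoset

/-! ### Coordinatization: points as complementary pairs, lines as triads. -/

namespace OrthomodularPoset

variable {A : Type u} [OrthomodularPoset A] {a b c : A}

theorem mem_fourSet_iff (ha : b ≠ ⊥) (ha' : b ≠ ⊤) : b ∈ fourSet a ↔ b = a ∨ b = aᶜ := by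
  simp [fourSet, ha, ha']

theorem fourSet_compl (a : A) : fourSet aᶜ = fourSet a := by
  ext y
  simp only [fourSet, compl_compl, Set.mem_insert_iff, Set.mem_singleton_iff]
  tauto

/-- The point of the geometry of `A` given by a proper element. -/
def toPoint (a : A) (ha : a ≠ ⊥) (ha' : a ≠ ⊤) : Point A :=
  ⟨fourSet a, isBooleanSubalgebra_fourSet ha ha'⟩

theorem exists_eq_toPoint (p : Point A) : ∃ a ha ha', p = toPoint a ha ha' := by
  obtain ⟨S, hS, h4⟩ := p
  obtain ⟨a, ha, ha', rfl⟩ := exists_eq_fourSet hS h4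
  exact ⟨a, ha, ha', rfl⟩

theorem toPoint_eq_of_mem {p : Point A} (hp : a ∈ p.1) (ha : a ≠ ⊥) (ha' : a ≠ ⊤) :
    p = toPoint a ha ha' := by
  obtain ⟨b, hb, hb', rfl⟩ := exists_eq_toPoint p
  rcases (mem_fourSet_iff ha ha').1 hp with rfl | rfl
  · rfl
  · exact Subtype.ext (fourSet_compl b).symm

theorem self_mem_fourSet (a : A) : a ∈ fourSet a := by simp [fourSet]

theorem setOf_subset_eightSet (h : Triad a b c) {p q r : Point A} (hp : a ∈ p.1) (hq : b ∈ q.1)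
    (hr : c ∈ r.1) : {s : Point A | s.1 ⊆ eightSet a b c} = {p, q, r} := by
  have hT := (isBooleanSubalgebra_eightSet h).1
  have ha := h.left_ne_top
  have hb := h.rot.left_ne_top
  have hc := h.rot.rot.left_ne_top
  rw [toPoint_eq_of_mem hp h.left_ne ha, toPoint_eq_of_mem hq h.mid_ne hb,
    toPoint_eq_of_mem hr h.right_ne hc]
  ext s
  simp only [Set.mem_ofPred_eq, Set.mem_insert_iff, Set.mem_singleton_iff]
  constructor
  · intro hs
    obtain ⟨e, he, he', rfl⟩ := exists_eq_toPoint s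
    have := hs (self_mem_fourSet e)
    simp only [eightSet, Set.mem_insert_iff, Set.mem_singleton_iff, he, he', false_or] at this
    rcases this with rfl | rfl | rfl | rfl | rfl | rfl
    exacts [Or.inl rfl, Or.inr (Or.inl rfl), Or.inr (Or.inr rfl),
      Or.inl (Subtype.ext (fourSet_compl a)), Or.inr (Or.inl (Subtype.ext (fourSet_compl b))),
      Or.inr (Or.inr (Subtype.ext (fourSet_compl c)))]
  · rintro (rfl | rfl | rfl) <;> exact fourSet_subset hT (by simp [eightSet])

theorem mem_geometry_lines_iff {l : Set (Point A)} :
    l ∈ (geometry A).lines ↔ ∃ (a b c : A) (p q r : Point A), Triad a b c ∧ a ∈ p.1 ∧ b ∈ q.1 ∧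
      c ∈ r.1 ∧ l = {p, q, r} := by
  constructor
  · rintro ⟨T, hT, h8, rfl⟩
    obtain ⟨a, b, c, h, rfl⟩ := exists_eq_eightSet hT h8
    have ha := self_mem_fourSet a
    have hb := self_mem_fourSet b
    have hc := self_mem_fourSet c
    exact ⟨a, b, c, toPoint a h.left_ne h.left_ne_top, toPoint b h.mid_ne h.rot.left_ne_top,
      toPoint c h.right_ne h.rot.rot.left_ne_top, h, ha, hb, hc,
      setOf_subset_eightSet h ha hb hc⟩
  · rintro ⟨a, b, c, p, q, r, h, hp, hq, hr, rfl⟩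
    have := isBooleanSubalgebra_eightSet h
    exact ⟨_, this.1, this.2, (setOf_subset_eightSet h hp hq hr).symm⟩

/-- The points of the geometry `G` are the complementary pairs of proper elements of `A`, where
`R p a` says that `a` belongs to `p`, and the lines of `G` are the triads of `A`. -/
structure IsCoordinatization {P : Type u} (G : PointLineGeometry P) (R : P → A → Prop) :
    Prop where
  exists_rel : ∀ p, ∃ a, R p a
  ne_bot : ∀ {p a}, R p a → a ≠ ⊥
  ne_top : ∀ {p a}, R p a → a ≠ ⊤
  exists_point : ∀ {a}, a ≠ ⊥ → a ≠ ⊤ → ∃ p, R p a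
  rel_iff : ∀ {p a b}, R p a → (R p b ↔ b = a ∨ b = aᶜ)
  point_unique : ∀ {p q a}, R p a → R q a → p = q
  mem_lines : ∀ {l}, l ∈ G.lines ↔ ∃ a b c p q r, Triad a b c ∧ R p a ∧ R q b ∧ R r c ∧
    l = {p, q, r}

theorem exists_isCoordinatization_of_iso {P : Type u} {G : PointLineGeometry P}
    (e : G.Iso (geometry A)) : ∃ R : P → A → Prop, IsCoordinatization G R := by
  refine ⟨fun p a => a ∈ (e.toEquiv p).1 ∧ a ≠ ⊥ ∧ a ≠ ⊤, ?_, fun h => h.2.1, fun h => h.2.2,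
    ?_, ?_, ?_, ?_⟩
  · intro p
    obtain ⟨a, ha, ha', h⟩ := exists_eq_toPoint (e.toEquiv p)
    exact ⟨a, h ▸ self_mem_fourSet a, ha, ha'⟩
  · intro a ha ha'
    refine ⟨e.toEquiv.symm (toPoint a ha ha'), ?_, ha, ha'⟩
    rw [Equiv.apply_symm_apply]
    exact self_mem_fourSet a
  · rintro p a b ⟨hp, ha, ha'⟩
    have h1 : aᶜ ≠ ⊥ := fun h => ha' (by rw [← compl_compl a, h, compl_bot])
    have h2 : aᶜ ≠ ⊤ := fun h => ha (by rw [← compl_compl a, h, compl_top])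
    rw [toPoint_eq_of_mem hp ha ha']
    constructor
    · rintro ⟨h, hb, hb'⟩
      exact (mem_fourSet_iff hb hb').1 h
    · rintro (rfl | rfl)
      exacts [⟨self_mem_fourSet _, ha, ha'⟩, ⟨(mem_fourSet_iff h1 h2).2 (Or.inr rfl), h1, h2⟩]
  · rintro p q a ⟨hp, ha, ha'⟩ ⟨hq, -, -⟩
    exact e.toEquiv.injective
      ((toPoint_eq_of_mem hp ha ha').trans (toPoint_eq_of_mem hq ha ha').symm)
  · intro l
    rw [e.mem_lines_iff, mem_geometry_lines_iff]
    constructor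
    · rintro ⟨a, b, c, p, q, r, h, hp, hq, hr, hl⟩
      refine ⟨a, b, c, e.toEquiv.symm p, e.toEquiv.symm q, e.toEquiv.symm r, h,
        ⟨by simpa, h.left_ne, h.left_ne_top⟩, ⟨by simpa, h.mid_ne, h.rot.left_ne_top⟩,
        ⟨by simpa, h.right_ne, h.rot.rot.left_ne_top⟩, ?_⟩
      apply e.toEquiv.injective.image_injective
      rw [hl]
      simp [Set.image_insert_eq]
    · rintro ⟨a, b, c, p, q, r, h, hp, hq, hr, rfl⟩
      exact ⟨a, b, c, _, _, _, h, hp.1, hq.1, hr.1, by simp [Set.image_insert_eq]⟩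

/-- Either element of a pair generates the same 4-element subalgebra, so an arbitrary representative
of each point defines the isomorphism. -/
theorem IsCoordinatization.nonempty_iso {P : Type u} {G : PointLineGeometry P} {R : P → A → Prop}
    (hR : IsCoordinatization G R) : Nonempty (G.Iso (geometry A)) := by
  choose σ hσ using hR.exists_rel
  let f : P → Point A := fun p => toPoint (σ p) (hR.ne_bot (hσ p)) (hR.ne_top (hσ p))
  have hf : ∀ {p a}, a ≠ ⊥ → a ≠ ⊤ → (R p a ↔ a ∈ (f p).1) := fun {p a} h h' => by
    rw [hR.rel_iff (hσ p), ← mem_fourSet_iff h h']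
    rfl
  have hf' : ∀ {p a}, R p a → a ∈ (f p).1 := fun h => (hf (hR.ne_bot h) (hR.ne_top h)).1 h
  have hinj : Function.Injective f := fun p q h => by
    have h1 := hR.ne_bot (hσ p)
    have h2 := hR.ne_top (hσ p)
    exact hR.point_unique (hσ p) ((hf h1 h2).2 (h ▸ hf' (hσ p)))
  have hsurj : Function.Surjective f := fun s => by
    obtain ⟨a, ha, ha', rfl⟩ := exists_eq_toPoint s
    obtain ⟨p, hp⟩ := hR.exists_point ha ha'
    exact ⟨p, toPoint_eq_of_mem (hf' hp) ha ha'⟩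
  refine ⟨Equiv.ofBijective f ⟨hinj, hsurj⟩, fun l => ?_⟩
  rw [hR.mem_lines, mem_geometry_lines_iff]
  constructor
  · rintro ⟨a, b, c, p, q, r, h, hp, hq, hr, rfl⟩
    refine ⟨a, b, c, _, _, _, h, hf' hp, hf' hq, hf' hr, ?_⟩
    change f '' _ = _
    simp [Set.image_insert_eq]
  · rintro ⟨a, b, c, p, q, r, h, hp, hq, hr, hl⟩
    obtain ⟨p, rfl⟩ := hsurj p
    obtain ⟨q, rfl⟩ := hsurj q
    obtain ⟨r, rfl⟩ := hsurj r
    refine ⟨a, b, c, p, q, r, h, (hf h.left_ne h.left_ne_top).2 hp,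
      (hf h.mid_ne h.rot.left_ne_top).2 hq, (hf h.right_ne h.rot.rot.left_ne_top).2 hr, ?_⟩
    apply hinj.image_injective
    change f '' l = _ at hl
    simpa [Set.image_insert_eq] using hl

end OrthomodularPoset

open OrthomodularPoset in
theorem PreOrthogeometry.isOrthogeometry_iff {P : Type u} (G : PreOrthogeometry P) :
    G.IsOrthogeometry ↔ ∃ (A : Type u) (_ : OrthomodularPoset A) (R : P → A → Prop),
      IsCoordinatization G.toPointLineGeometry R :=
  ⟨fun ⟨A, hA, ⟨e⟩⟩ => ⟨A, hA, exists_isCoordinatization_of_iso e⟩,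
    fun ⟨A, hA, _, hR⟩ => ⟨A, hA, hR.nonempty_iso⟩⟩

/-! ### Planes described by seven labelled points. -/

namespace PreOrthogeometry

variable {P : Type u} (G : PreOrthogeometry P)

/-- Two points that lie on a common line. -/
def Collinear (p q : P) : Prop := ∃ l ∈ G.lines, p ∈ l ∧ q ∈ l

/-- Seven points forming a plane: a triangle `a b c` with centre `d` and midpoints `x`, `y`, `z`. -/
structure IsQuad (a b c d x y z : P) : Prop where
  abx : {a, b, x} ∈ G.lines
  acy : {a, c, y} ∈ G.lines
  bcz : {b, c, z} ∈ G.lines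
  cdx : {c, d, x} ∈ G.lines
  bdy : {b, d, y} ∈ G.lines
  adz : {a, d, z} ∈ G.lines
  nodup : [a, b, c, d, x, y, z].Nodup
  xy : ¬ G.Collinear x y
  xz : ¬ G.Collinear x z
  yz : ¬ G.Collinear y z

variable {G} {a b c d x y z p q r : P} {l m w : Set P}

theorem eq_of_mem (hl : l ∈ G.lines) (hm : m ∈ G.lines) (h : p ≠ q) (hpl : p ∈ l) (hql : q ∈ l)
    (hpm : p ∈ m) (hqm : q ∈ m) : l = m :=
  G.line_unique p q h l hl m hm hpl hql hpm hqm

theorem Collinear.symm (h : G.Collinear p q) : G.Collinear q p := by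
  obtain ⟨l, hl, hp, hq⟩ := h
  exact ⟨l, hl, hq, hp⟩

theorem ne_of_mem_lines (h : {p, q, r} ∈ G.lines) : p ≠ q ∧ p ≠ r ∧ q ≠ r := by
  have h3 := G.ncard_line _ h
  have h2 : ∀ s t : P, ({s, t} : Set P).ncard ≤ 2 := fun s t =>
    (Set.ncard_insert_le s {t}).trans (by rw [Set.ncard_singleton])
  refine ⟨?_, ?_, ?_⟩ <;> rintro rfl
  · have := h2 p r
    simp only [Set.mem_insert_iff, true_or, Set.insert_eq_of_mem] at h3
    omega
  · have := h2 q p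
    rw [Set.insert_comm, Set.pair_eq_singleton] at h3
    omega
  · have := h2 p q
    rw [Set.pair_eq_singleton] at h3
    omega

theorem exists_eq_of_mem_lines (hl : l ∈ G.lines) (hp : p ∈ l) (hq : q ∈ l) (h : p ≠ q) :
    ∃ r, l = {p, q, r} := by
  obtain ⟨s, t, v, -, -, -, rfl⟩ := Set.ncard_eq_three.1 (G.ncard_line l hl)
  simp only [Set.mem_insert_iff, Set.mem_singleton_iff] at hp hq
  rcases hp with rfl | rfl | rfl <;> rcases hq with rfl | rfl | rfl <;>
    first
    | exact absurd rfl h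
    | skip
  · exact ⟨v, rfl⟩
  · exact ⟨t, by rw [Set.pair_comm]⟩
  · exact ⟨v, Set.insert_comm _ _ _⟩
  · exact ⟨s, by rw [Set.insert_comm, Set.pair_comm]⟩
  · exact ⟨t, by rw [Set.pair_comm, Set.insert_comm]⟩
  · exact ⟨s, by rw [Set.insert_comm, Set.pair_comm, Set.insert_comm]⟩

/-- The points of a quad. -/
def quadSet (a b c d x y z : P) : Set P := {a, b, c, d, x, y, z}

namespace IsQuad

/-- The centre is on the same footing as the corners: the six lines join the pairs from {a, b, c,
d}, and x, y, z correspond to the three splittings into two pairs. This transposition and the next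
two generate all permutations of the four vertices. -/
theorem swap_bc (h : G.IsQuad a b c d x y z) : G.IsQuad a c b d y x z where
  abx := h.acy
  acy := h.abx
  bcz := Set.insert_comm b c {z} ▸ h.bcz
  cdx := h.bdy
  bdy := h.cdx
  adz := h.adz
  nodup := by have := h.nodup; grind
  xy := fun h' => h.xy h'.symm
  xz := h.yz
  yz := h.xz

theorem swap_ab (h : G.IsQuad a b c d x y z) : G.IsQuad b a c d x z y where
  abx := Set.insert_comm a b {x} ▸ h.abx
  acy := h.bcz
  bcz := h.acy
  cdx := h.cdx
  bdy := h.adz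
  adz := h.bdy
  nodup := by have := h.nodup; grind
  xy := h.xz
  xz := h.xy
  yz := fun h' => h.yz h'.symm

theorem swap_cd (h : G.IsQuad a b c d x y z) : G.IsQuad a b d c x z y where
  abx := h.abx
  acy := h.adz
  bcz := h.bdy
  cdx := Set.insert_comm c d {x} ▸ h.cdx
  bdy := h.bcz
  adz := h.acy
  nodup := by have := h.nodup; grind
  xy := h.xz
  xz := h.xy
  yz := fun h' => h.yz h'.symm

/-- Any two of the seven points lie on one of the six lines unless both are midpoints, and midpoints
are pairwise non-collinear; uniqueness of lines does the rest. -/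
theorem eq_line (h : G.IsQuad a b c d x y z) (hl : l ∈ G.lines)
    (hl' : (l ∩ quadSet a b c d x y z).Nontrivial) :
    l = {a, b, x} ∨ l = {a, c, y} ∨ l = {b, c, z} ∨ l = {c, d, x} ∨ l = {b, d, y} ∨
      l = {a, d, z} := by
  obtain ⟨s, ⟨hsl, hs⟩, t, ⟨htl, ht⟩, hst⟩ := hl'
  have hxy : x ∈ l → y ∈ l → False := fun h1 h2 => h.xy ⟨l, hl, h1, h2⟩
  have hxz : x ∈ l → z ∈ l → False := fun h1 h2 => h.xz ⟨l, hl, h1, h2⟩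
  have hyz : y ∈ l → z ∈ l → False := fun h1 h2 => h.yz ⟨l, hl, h1, h2⟩
  have h1 := fun hp hq => eq_of_mem (p := s) (q := t) hl h.abx hst hsl htl hp hq
  have h2 := fun hp hq => eq_of_mem (p := s) (q := t) hl h.acy hst hsl htl hp hq
  have h3 := fun hp hq => eq_of_mem (p := s) (q := t) hl h.bcz hst hsl htl hp hq
  have h4 := fun hp hq => eq_of_mem (p := s) (q := t) hl h.cdx hst hsl htl hp hq
  have h5 := fun hp hq => eq_of_mem (p := s) (q := t) hl h.bdy hst hsl htl hp hq
  have h6 := fun hp hq => eq_of_mem (p := s) (q := t) hl h.adz hst hsl htl hp hq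
  simp only [quadSet, Set.mem_insert_iff, Set.mem_singleton_iff] at hs ht h1 h2 h3 h4 h5 h6
  clear h
  generalize ({a, b, x} : Set P) = l₁ at *
  generalize ({a, c, y} : Set P) = l₂ at *
  generalize ({b, c, z} : Set P) = l₃ at *
  generalize ({c, d, x} : Set P) = l₄ at *
  generalize ({b, d, y} : Set P) = l₅ at *
  generalize ({a, d, z} : Set P) = l₆ at *
  rcases hs with rfl | rfl | rfl | rfl | rfl | rfl | rfl <;> grind

theorem isSubspace (h : G.IsQuad a b c d x y z) : G.IsSubspace (quadSet a b c d x y z) := by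
  intro l hl hl'
  rcases h.eq_line hl hl' with rfl | rfl | rfl | rfl | rfl | rfl <;>
    rintro s (rfl | rfl | rfl) <;> simp [quadSet]

theorem isPlane (h : G.IsQuad a b c d x y z) : G.IsPlane (quadSet a b c d x y z) := by
  refine ⟨h.isSubspace, a, b, c, d, x, y, z, h.nodup, rfl, Set.Subset.antisymm ?_ ?_⟩
  · rintro l ⟨hl, hl'⟩
    exact h.eq_line hl hl'
  · have hn := h.nodup
    simp only [List.nodup_cons, List.mem_cons, not_or] at hn
    rintro l (rfl | rfl | rfl | rfl | rfl | rfl)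
    · exact ⟨h.abx, a, by simp [quadSet], b, by simp [quadSet], by tauto⟩
    · exact ⟨h.acy, a, by simp [quadSet], c, by simp [quadSet], by tauto⟩
    · exact ⟨h.bcz, b, by simp [quadSet], c, by simp [quadSet], by tauto⟩
    · exact ⟨h.cdx, c, by simp [quadSet], d, by simp [quadSet], by tauto⟩
    · exact ⟨h.bdy, b, by simp [quadSet], d, by simp [quadSet], by tauto⟩
    · exact ⟨h.adz, a, by simp [quadSet], d, by simp [quadSet], by tauto⟩

/-- The quad in which the sides through `x` exchange their roles. -/
theorem swap_sides (h : G.IsQuad a b c d x y z) : G.IsQuad c d a b x y z :=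
  h.swap_bc.swap_ab.swap_cd.swap_bc

theorem lines_through_midpoint (h : G.IsQuad a b c d x y z) (hl : l ∈ G.lines) (hx : x ∈ l)
    (hp : p ∈ l) (hp' : p ∈ quadSet a b c d x y z) (hne : p ≠ x) :
    l = {a, b, x} ∨ l = {c, d, x} := by
  have hn := h.nodup
  rcases h.eq_line hl ⟨p, ⟨hp, hp'⟩, x, ⟨hx, by simp [quadSet]⟩, hne⟩ with
    rfl | rfl | rfl | rfl | rfl | rfl
  · exact Or.inl rfl
  · clear h; grind
  · clear h; grind
  · exact Or.inr rfl
  · clear h; grind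
  · clear h; grind

end IsQuad

theorem IsPlane.exists_isQuad (h : G.IsPlane w) :
    ∃ a b c d x y z, G.IsQuad a b c d x y z ∧ w = quadSet a b c d x y z := by
  obtain ⟨-, a, b, c, d, x, y, z, hn, rfl, hl⟩ := h
  refine ⟨a, b, c, d, x, y, z, ?_, rfl⟩
  have hmem : ∀ l, l ∈ ({{a, b, x}, {a, c, y}, {b, c, z}, {c, d, x}, {b, d, y}, {a, d, z}} :
      Set (Set P)) → l ∈ G.lines := fun l h => by
    rw [← hl] at h
    exact h.1
  have hcol : ∀ l ∈ G.lines, ∀ s ∈ l, ∀ t ∈ l, s ∈ quadSet a b c d x y z →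
      t ∈ quadSet a b c d x y z → s ≠ t →
      l ∈ ({{a, b, x}, {a, c, y}, {b, c, z}, {c, d, x}, {b, d, y}, {a, d, z}} :
      Set (Set P)) := fun l h s hs t ht hs' ht' hst => by
    rw [← hl]
    exact ⟨h, s, ⟨hs, hs'⟩, t, ⟨ht, ht'⟩, hst⟩
  refine ⟨hmem _ (by simp), hmem _ (by simp), hmem _ (by simp), hmem _ (by simp),
    hmem _ (by simp), hmem _ (by simp), hn, ?_, ?_, ?_⟩
  · rintro ⟨l, hl, h1, h2⟩
    have := hcol l hl x h1 y h2 (by simp [quadSet]) (by simp [quadSet]) (by grind)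
    clear hcol hmem
    rcases this with rfl | rfl | rfl | rfl | rfl | rfl <;> grind
  · rintro ⟨l, hl, h1, h2⟩
    have := hcol l hl x h1 z h2 (by simp [quadSet]) (by simp [quadSet]) (by grind)
    clear hcol hmem
    rcases this with rfl | rfl | rfl | rfl | rfl | rfl <;> grind
  · rintro ⟨l, hl, h1, h2⟩
    have := hcol l hl y h1 z h2 (by simp [quadSet]) (by simp [quadSet]) (by grind)
    clear hcol hmem
    rcases this with rfl | rfl | rfl | rfl | rfl | rfl <;> grind

theorem mem_quadSet : p ∈ quadSet a b c d x y z ↔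
    p = a ∨ p = b ∨ p = c ∨ p = d ∨ p = x ∨ p = y ∨ p = z := by
  simp [quadSet]

theorem quadSet_swap_bc : quadSet a c b d y x z = quadSet a b c d x y z := by
  ext p
  simp only [mem_quadSet]
  tauto

theorem quadSet_swap_ab : quadSet b a c d x z y = quadSet a b c d x y z := by
  ext p
  simp only [mem_quadSet]
  tauto

theorem quadSet_swap_cd : quadSet a b d c x z y = quadSet a b c d x y z := by
  ext p
  simp only [mem_quadSet]
  tauto

/-- The symmetries act transitively on the vertices and on the midpoints. -/
theorem IsQuad.exists_relabel (h : G.IsQuad a b c d x y z) (hp : p ∈ quadSet a b c d x y z) :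
    ∃ a' b' c' d' x' y' z', G.IsQuad a' b' c' d' x' y' z' ∧
      quadSet a' b' c' d' x' y' z' = quadSet a b c d x y z ∧ (p = a' ∨ p = x') := by
  rcases mem_quadSet.1 hp with rfl | rfl | rfl | rfl | rfl | rfl | rfl
  · exact ⟨_, _, _, _, _, _, _, h, rfl, Or.inl rfl⟩
  · exact ⟨_, _, _, _, _, _, _, h.swap_ab, quadSet_swap_ab, Or.inl rfl⟩
  · exact ⟨_, _, _, _, _, _, _, h.swap_bc.swap_ab, quadSet_swap_ab.trans quadSet_swap_bc,
      Or.inl rfl⟩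
  · exact ⟨_, _, _, _, _, _, _, h.swap_cd.swap_bc.swap_ab,
      quadSet_swap_ab.trans (quadSet_swap_bc.trans quadSet_swap_cd), Or.inl rfl⟩
  · exact ⟨_, _, _, _, _, _, _, h, rfl, Or.inr rfl⟩
  · exact ⟨_, _, _, _, _, _, _, h.swap_bc, quadSet_swap_bc, Or.inr rfl⟩
  · exact ⟨_, _, _, _, _, _, _, h.swap_cd.swap_bc, quadSet_swap_bc.trans quadSet_swap_cd,
      Or.inr rfl⟩

/-- Two lines are the only lines through `p` in some plane iff they are the side and the median
through a midpoint of a quad. -/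
theorem exists_isPlane_iff_exists_isQuad (hl : l ∈ G.lines) (hm : m ∈ G.lines) (hp : p ∈ l) :
    (∃ w, G.IsPlane w ∧ {n | n ∈ G.lines ∧ n ⊆ w ∧ p ∈ n} = {l, m}) ↔
      ∃ a b c d y z, G.IsQuad a b c d p y z ∧ l = {a, b, p} ∧ m = {c, d, p} := by
  constructor
  · rintro ⟨w, hw, hlm⟩
    obtain ⟨a, b, c, d, x, y, z, hq, rfl⟩ := hw.exists_isQuad
    have hlw : l ⊆ quadSet a b c d x y z := by
      have : l ∈ ({l, m} : Set (Set P)) := by simp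
      rw [← hlm] at this
      exact this.2.1
    obtain ⟨a', b', c', d', x', y', z', hq', heq, hp'⟩ := hq.exists_relabel (hlw hp)
    rw [← heq] at hlm
    have hn := hq'.nodup
    have key : ∀ n ∈ G.lines, p ∈ n → n ⊆ quadSet a' b' c' d' x' y' z' → n = l ∨ n = m := by
      intro n h1 h2 h3
      have : n ∈ ({l, m} : Set (Set P)) := by
        rw [← hlm]
        exact ⟨h1, h3, h2⟩
      exact this
    clear hq hlw heq hw
    rcases hp' with rfl | rfl
    -- A vertex lies on three distinct lines of the plane, which cannot all be among l and m.
    · exfalso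
      have h1 := key _ hq'.abx (by simp) (by rintro s (rfl | rfl | rfl) <;> simp [quadSet])
      have h2 := key _ hq'.acy (by simp) (by rintro s (rfl | rfl | rfl) <;> simp [quadSet])
      have h3 := key _ hq'.adz (by simp) (by rintro s (rfl | rfl | rfl) <;> simp [quadSet])
      have e1 : ({p, b', x'} : Set P) ≠ {p, c', y'} := fun h => by
        have : b' ∈ ({p, c', y'} : Set P) := by simp [← h]
        clear hq'; grind
      have e2 : ({p, b', x'} : Set P) ≠ {p, d', z'} := fun h => by
        have : b' ∈ ({p, d', z'} : Set P) := by simp [← h]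
        clear hq'; grind
      have e3 : ({p, c', y'} : Set P) ≠ {p, d', z'} := fun h => by
        have : c' ∈ ({p, d', z'} : Set P) := by simp [← h]
        clear hq'; grind
      rcases h1 with rfl | rfl <;> rcases h2 with h2 | h2 <;> rcases h3 with h3 | h3 <;>
        first
        | exact e1 h2.symm
        | exact e2 h3.symm
        | exact e3 (h2.trans h3.symm)
    · have h1 := key _ hq'.abx (by simp) (by rintro s (rfl | rfl | rfl) <;> simp [quadSet])
      have h2 := key _ hq'.cdx (by simp) (by rintro s (rfl | rfl | rfl) <;> simp [quadSet])
      have e1 : ({a', b', p} : Set P) ≠ {c', d', p} := fun h => by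
        have : a' ∈ ({c', d', p} : Set P) := by simp [← h]
        clear hq'; grind
      rcases h1 with rfl | rfl <;> rcases h2 with h2 | h2
      · exact absurd h2.symm e1
      · exact ⟨_, _, _, _, _, _, hq', rfl, h2.symm⟩
      · exact ⟨_, _, _, _, _, _, hq'.swap_sides, h2.symm, rfl⟩
      · exact absurd h2.symm e1
  · rintro ⟨a, b, c, d, y, z, hq, rfl, rfl⟩
    refine ⟨_, hq.isPlane, Set.Subset.antisymm ?_ ?_⟩
    · rintro n ⟨hn, hnw, hpn⟩
      obtain ⟨s, t, v, hst, -, -, rfl⟩ := Set.ncard_eq_three.1 (G.ncard_line n hn)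
      by_cases hs : s = p
      · exact hq.lines_through_midpoint hn hpn (p := t) (by simp) (hnw (by simp))
          (fun h => hst (hs.trans h.symm))
      · exact hq.lines_through_midpoint hn hpn (p := s) (by simp) (hnw (by simp)) hs
    · rintro n (rfl | rfl)
      · exact ⟨hq.abx, by rintro s (rfl | rfl | rfl) <;> simp [quadSet], by simp⟩
      · exact ⟨hq.cdx, by rintro s (rfl | rfl | rfl) <;> simp [quadSet], by simp⟩

end PreOrthogeometry

/-! ### Necessity: planes and directions from an orthomodular poset. -/

namespace OrthomodularPoset

open PreOrthogeometry

variable {A : Type u} [OrthomodularPoset A] {a b c d u v : A}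

/-- Here v is the complement of a ∨ c, and b ∨ d ≤ v. If this were strict, the nonzero remainder f
of b ∨ d in v would be orthogonal to a, b, c and d, hence below both u and uᶜ. -/
theorem Triad.exists_chain (h : Triad a b u) (h' : Triad c d uᶜ) :
    ∃ v, Triad a c v ∧ Triad b d vᶜ := by
  have hau := h.left_le
  have hbu := h.mid_le
  have hcu := compl_compl u ▸ h'.left_le
  have hdu := compl_compl u ▸ h'.mid_le
  have hac : a ≤ cᶜ := hau.trans (compl_le_compl.2 hcu)
  obtain ⟨v, hv⟩ := exists_triad h.left_ne h'.left_ne hac (by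
    rintro rfl
    exact h.mid_ne (eq_bot_of_le ((le_compl_comm.1 h.orth).trans ((compl_compl c).le.trans hcu)) hbu))
  refine ⟨v, hv, ?_⟩
  have hbv : b ≤ v := hv.le_of_le (le_compl_comm.1 h.orth) (hbu.trans (compl_le_compl.2 hcu))
  have hdv : d ≤ v := hv.le_of_le (hdu.trans (le_compl_comm.1 hau)) (le_compl_comm.1 h'.orth)
  have hbd : b ≤ dᶜ := hbu.trans (compl_le_compl.2 hdu)
  obtain ⟨e, he⟩ := exists_triad h.mid_ne h'.mid_ne hbd (by
    rintro rfl
    exact h.left_ne (eq_bot_of_le (h.orth.trans ((compl_compl d).le.trans hdu)) hau))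
  have hev : eᶜ ≤ v := he.compl_le hbv hdv
  suffices v = eᶜ by rwa [this, compl_compl]
  by_contra hne
  obtain ⟨f, hf⟩ := exists_triad (a := eᶜ) (b := vᶜ)
    (fun h0 => h.mid_ne (le_bot_iff.1 (h0 ▸ he.left_le)))
    (fun h0 => h.left_ne (le_bot_iff.1 (h0 ▸ hv.left_le)))
    ((compl_compl v).symm ▸ hev) (fun h0 => hne (by rw [h0, compl_compl]))
  have hfe : f ≤ e := compl_compl e ▸ hf.rot.rot.orth
  have hfv : f ≤ v := compl_compl v ▸ hf.rot.rot.left_le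
  refine hf.right_ne (eq_bot_of_le (a := u) (h.le_of_le ?_ ?_) (h'.le_of_le ?_ ?_))
  · exact hfv.trans hv.rot.rot.orth
  · exact hfe.trans he.rot.rot.orth
  · exact hfv.trans (le_compl_comm.1 hv.mid_le)
  · exact hfe.trans (le_compl_comm.1 he.mid_le)

namespace IsCoordinatization

variable {P : Type u} {G : PreOrthogeometry P} {R : P → A → Prop} {p q r s t x y : P} {l m : Set P}

theorem rel_compl (hR : IsCoordinatization G.toPointLineGeometry R) (h : R p a) : R p aᶜ :=
  (hR.rel_iff h).2 (Or.inr rfl)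

theorem mem_line (hR : IsCoordinatization G.toPointLineGeometry R) (h : Triad a b c) (hp : R p a)
    (hq : R q b) (hr : R r c) : {p, q, r} ∈ G.lines :=
  hR.mem_lines.2 ⟨a, b, c, p, q, r, h, hp, hq, hr, rfl⟩

theorem exists_triad_of_mem (hR : IsCoordinatization G.toPointLineGeometry R) (hl : l ∈ G.lines)
    (hp : p ∈ l) (hq : q ∈ l) (hpq : p ≠ q) :
    ∃ a b c r, Triad a b c ∧ R p a ∧ R q b ∧ R r c ∧ l = {p, q, r} := by
  obtain ⟨a, b, c, s, t, v, h, hs, ht, hv, rfl⟩ := hR.mem_lines.1 hl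
  simp only [Set.mem_insert_iff, Set.mem_singleton_iff] at hp hq
  rcases hp with rfl | rfl | rfl <;> rcases hq with rfl | rfl | rfl <;>
    first
    | exact absurd rfl hpq
    | skip
  · exact ⟨_, _, _, _, h, hs, ht, hv, rfl⟩
  · exact ⟨_, _, _, _, h.rot.rot.swap, hs, hv, ht, by rw [Set.pair_comm]⟩
  · exact ⟨_, _, _, _, h.swap, ht, hs, hv, Set.insert_comm _ _ _⟩
  · exact ⟨_, _, _, _, h.rot, ht, hv, hs, by rw [Set.insert_comm, Set.pair_comm]⟩
  · exact ⟨_, _, _, _, h.rot.rot, hv, hs, ht, by rw [Set.pair_comm, Set.insert_comm]⟩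
  · exact ⟨_, _, _, _, h.rot.swap, hv, ht, hs,
      by rw [Set.insert_comm, Set.pair_comm, Set.insert_comm]⟩

theorem comparable (hR : IsCoordinatization G.toPointLineGeometry R) (h : G.Collinear p q)
    (hpq : p ≠ q) (ha : R p a) (hb : R q b) : a ≤ bᶜ ∨ a ≤ b ∨ b ≤ a ∨ aᶜ ≤ b := by
  obtain ⟨l, hl, hp, hq⟩ := h
  obtain ⟨a', b', c', r, h, hp', hq', -⟩ := hR.exists_triad_of_mem hl hp hq hpq
  have := h.orth
  rcases (hR.rel_iff ha).1 hp' with rfl | rfl <;> rcases (hR.rel_iff hb).1 hq' with rfl | rfl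
  · exact Or.inl this
  · exact Or.inr (Or.inl (compl_compl b ▸ this))
  · exact Or.inr (Or.inr (Or.inl (compl_le_compl.1 this)))
  · exact Or.inr (Or.inr (Or.inr (compl_compl b ▸ this)))

/-- Collinearity would make u or uᶜ orthogonal to v or vᶜ. But d lies below u and v, c below u and
vᶜ, b below uᶜ and v, a below uᶜ and vᶜ, and all four are nonzero. -/
theorem not_collinear (hR : IsCoordinatization G.toPointLineGeometry R) (h : Triad a b u)
    (h' : Triad c d uᶜ) (hv : Triad a c v) (hv' : Triad b d vᶜ) (hx : R x u) (hy : R y v) :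
    ¬ G.Collinear x y := by
  have hau := h.left_le
  have hbu := h.mid_le
  have hcu := compl_compl u ▸ h'.left_le
  have hdu := compl_compl u ▸ h'.mid_le
  have hav := hv.left_le
  have hcv := hv.mid_le
  have hbv := compl_compl v ▸ hv'.left_le
  have hdv := compl_compl v ▸ hv'.mid_le
  intro hxy
  have hne : x ≠ y := by
    rintro rfl
    rcases (hR.rel_iff hx).1 hy with rfl | rfl
    · exact h'.left_ne (eq_bot_of_le hcu hcv)
    · exact h.left_ne (eq_bot_of_le (compl_compl u ▸ hav) hau)
  rcases hR.comparable hxy hne hx hy with h1 | h1 | h1 | h1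
  · exact h'.mid_ne (eq_bot_of_le hdv (hdu.trans h1))
  · exact h'.left_ne (eq_bot_of_le (hcu.trans h1) hcv)
  · exact h.mid_ne (eq_bot_of_le (hbv.trans h1) hbu)
  · exact h.left_ne (eq_bot_of_le (hau.trans h1) hav)

theorem exists_isQuad (hR : IsCoordinatization G.toPointLineGeometry R) (h : Triad a b u)
    (h' : Triad c d uᶜ) (hp : R p a) (hq : R q b) (hr : R r c) (hs : R s d) (hx : R x u) :
    ∃ y z, G.IsQuad p q r s x y z := by
  obtain ⟨v, hv, hv'⟩ := h.exists_chain h'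
  obtain ⟨w, hw, hw'⟩ := h.exists_chain h'.swap
  obtain ⟨y, hy⟩ := hR.exists_point hv.right_ne hv.rot.rot.left_ne_top
  obtain ⟨z, hz⟩ := hR.exists_point hw.right_ne hw.rot.rot.left_ne_top
  have hx' := hR.rel_compl hx
  have hy' := hR.rel_compl hy
  have hz' := hR.rel_compl hz
  have l1 := hR.mem_line h hp hq hx
  have l2 := hR.mem_line hv hp hr hy
  have l3 := hR.mem_line hw' hq hr hz'
  have l4 := hR.mem_line h' hr hs hx'
  have l5 := hR.mem_line hv' hq hs hy'
  have l6 := hR.mem_line hw hp hs hz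
  have n1 := hR.not_collinear h h' hv hv' hx hy
  have n2 := hR.not_collinear h h'.swap hw hw' hx hz
  have n3 := hR.not_collinear hv hv'.swap hw hw'.swap hy hz
  have e1 : x ≠ y := fun h0 => n1 (h0 ▸ ⟨_, l1, by simp, by simp⟩)
  have e2 : x ≠ z := fun h0 => n2 (h0 ▸ ⟨_, l1, by simp, by simp⟩)
  have e3 : y ≠ z := fun h0 => n3 (h0 ▸ ⟨_, l2, by simp, by simp⟩)
  refine ⟨y, z, l1, l2, l3, l4, l5, l6, ?_, n1, n2, n3⟩
  have m1 := ne_of_mem_lines l1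
  have m2 := ne_of_mem_lines l2
  have m3 := ne_of_mem_lines l3
  have m4 := ne_of_mem_lines l4
  have m5 := ne_of_mem_lines l5
  have m6 := ne_of_mem_lines l6
  simp only [List.nodup_cons, List.mem_cons, List.not_mem_nil, not_or]
  simp only [not_false_eq_true, and_true, List.nodup_nil]
  exact ⟨⟨m1.1, m2.1, m6.1, m1.2.1, m2.2.1, m6.2.1⟩, ⟨m3.1, m5.1, m1.2.2, m5.2.1, m3.2.1⟩,
    ⟨m4.1, m4.2.1, m2.2.2, m3.2.2⟩, ⟨m4.2.2, m5.2.2, m6.2.2⟩, ⟨e1, e2⟩, e3⟩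

/-- The three points become vertices: u is the complement of a ∨ b, and the fourth vertex is the
remainder of c in u, nonzero because c = u would put the points on a line. -/
theorem exists_isPlane_of_orth (hR : IsCoordinatization G.toPointLineGeometry R) (hp : R p a)
    (hq : R q b) (hr : R r c) (hpq : a ≤ bᶜ) (hpr : a ≤ cᶜ) (hqr : b ≤ cᶜ) (hne : p ≠ q)
    (hl : ¬ ∃ l ∈ G.lines, p ∈ l ∧ q ∈ l ∧ r ∈ l) :
    ∃ w, G.IsPlane w ∧ p ∈ w ∧ q ∈ w ∧ r ∈ w := by
  obtain ⟨u, hu⟩ := exists_triad (hR.ne_bot hp) (hR.ne_bot hq) hpq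
    (fun h => hne (hR.point_unique (hR.rel_compl hp) (by rw [h, compl_compl]; exact hq)))
  obtain ⟨x, hx⟩ := hR.exists_point hu.right_ne hu.rot.rot.left_ne_top
  have hcu : c ≤ u := hu.le_of_le (le_compl_comm.1 hpr) (le_compl_comm.1 hqr)
  obtain ⟨d, hd⟩ := exists_triad (a := c) (b := uᶜ) (hR.ne_bot hr)
    (hR.ne_bot (hR.rel_compl hx)) (by rwa [compl_compl]) (by
      rw [compl_compl]
      rintro rfl
      exact hl ⟨_, hR.mem_line hu hp hq hr, by simp, by simp, by simp⟩)
  obtain ⟨s, hs⟩ := hR.exists_point hd.right_ne hd.rot.rot.left_ne_top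
  obtain ⟨y, z, h⟩ := hR.exists_isQuad hu hd.rot.rot.swap hp hq hr hs hx
  exact ⟨_, h.isPlane, by simp [quadSet], by simp [quadSet], by simp [quadSet]⟩

/-- Now p becomes a midpoint: b and its remainder in a are two of the vertices, c and its remainder
in aᶜ the other two. -/
theorem exists_isPlane_of_chain (hR : IsCoordinatization G.toPointLineGeometry R) (hp : R p a)
    (hq : R q b) (hr : R r c) (hqp : b ≤ a) (hpr : a ≤ cᶜ) (hpq : p ≠ q) (hpr' : p ≠ r) :
    ∃ w, G.IsPlane w ∧ p ∈ w ∧ q ∈ w ∧ r ∈ w := by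
  have hp' := hR.rel_compl hp
  obtain ⟨e, he⟩ := exists_triad (hR.ne_bot hq) (hR.ne_bot hp') ((compl_compl a).symm ▸ hqp)
    (fun h => hpq (hR.point_unique hp (by rw [compl_compl] at h; exact h ▸ hq)))
  obtain ⟨f, hf⟩ := exists_triad (hR.ne_bot hr) (hR.ne_bot hp) (le_compl_comm.1 hpr)
    (fun h => hpr' (hR.point_unique hp' (h ▸ hr)))
  obtain ⟨s, hs⟩ := hR.exists_point he.right_ne he.rot.rot.left_ne_top
  obtain ⟨t, ht⟩ := hR.exists_point hf.right_ne hf.rot.rot.left_ne_top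
  obtain ⟨y, z, h⟩ := hR.exists_isQuad he.rot.rot.swap
    ((compl_compl a).symm ▸ hf.rot.rot.swap) hq hs hr ht hp'
  exact ⟨_, h.isPlane, by simp [quadSet], by simp [quadSet], by simp [quadSet]⟩

/-- The lines pq and pr select the same or opposite elements at p, and q, r are comparable up to
complements. Each combination is an orthogonal triple, a chain with one of the points in the middle,
or contradictory. -/
theorem exists_isPlane_of_triangle (hR : IsCoordinatization G.toPointLineGeometry R)
    (h : G.IsNondegenerateTriangle p q r) : ∃ w, G.IsPlane w ∧ p ∈ w ∧ q ∈ w ∧ r ∈ w := by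
  obtain ⟨hpq, hpr, hqr, ⟨l, hl, hpl, hql⟩, ⟨m, hm, hpm, hrm⟩, hqr', hno⟩ := h
  obtain ⟨a, b, e, s, hab, hp, hq, -⟩ := hR.exists_triad_of_mem hl hpl hql hpq
  obtain ⟨a', c, f, t, hac, hp', hr, -⟩ := hR.exists_triad_of_mem hm hpm hrm hpr
  have h3 := hR.comparable hqr' hqr hq hr
  have o1 := hab.orth
  have o2 := hac.orth
  rcases (hR.rel_iff hp).1 hp' with rfl | rfl
  · rcases h3 with h3 | h3 | h3 | h3
    · exact hR.exists_isPlane_of_orth hp hq hr o1 o2 h3 hpq hno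
    · obtain ⟨w, hw, h1, h2, h3⟩ := hR.exists_isPlane_of_chain hr hq hp h3
        (le_compl_comm.1 o2) hqr.symm hpr.symm
      exact ⟨w, hw, h3, h2, h1⟩
    · obtain ⟨w, hw, h1, h2, h3⟩ := hR.exists_isPlane_of_chain hq hr hp h3
        (le_compl_comm.1 o1) hqr hpq.symm
      exact ⟨w, hw, h3, h1, h2⟩
    · exact absurd (eq_bot_of_le ((o1.trans h3)) o2) hab.left_ne
  · have o2' : c ≤ a := compl_compl a ▸ le_compl_comm.1 o2
    rcases h3 with h3 | h3 | h3 | h3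
    · obtain ⟨w, hw, h1, h2, h3⟩ := hR.exists_isPlane_of_chain hp hr hq o2' o1 hpr hpq
      exact ⟨w, hw, h1, h3, h2⟩
    · exact absurd (eq_bot_of_le (h3.trans o2') (le_compl_comm.1 o1)) hab.mid_ne
    · exact absurd (eq_bot_of_le h3 (o2'.trans o1)) hac.mid_ne
    · have : a = bᶜ := le_antisymm o1 (h3.trans o2')
      exact absurd (hR.point_unique (hR.rel_compl hp) (by rw [this, compl_compl]; exact hq)) hpq

/-- The element `a` is an atom of the 8-element Boolean subalgebra of the line `l` through `p`. -/
def IsUp (R : P → A → Prop) (a : A) (p : P) (l : Set P) : Prop :=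
  ∃ b c q r, Triad a b c ∧ R q b ∧ R r c ∧ l = {p, q, r}

theorem isUp_or (hR : IsCoordinatization G.toPointLineGeometry R) (hp : R p a) (hl : l ∈ G.lines)
    (hpl : p ∈ l) : IsUp R a p l ∨ IsUp R aᶜ p l := by
  obtain ⟨s, hs, hsp⟩ : ∃ s ∈ l, s ≠ p := by
    obtain ⟨s, t, v, hst, -, -, rfl⟩ := Set.ncard_eq_three.1 (G.ncard_line l hl)
    by_cases hs : s = p
    · exact ⟨t, by simp, fun h => hst (hs.trans h.symm)⟩
    · exact ⟨s, by simp, hs⟩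
  obtain ⟨a', b, c, r, h, hp', hq, hr, rfl⟩ := hR.exists_triad_of_mem hl hpl hs hsp.symm
  rcases (hR.rel_iff hp).1 hp' with rfl | rfl
  · exact Or.inl ⟨_, _, _, _, h, hq, hr, rfl⟩
  · exact Or.inr ⟨_, _, _, _, h, hq, hr, rfl⟩

theorem IsUp.exists_triad (hR : IsCoordinatization G.toPointLineGeometry R) (hp : R p a)
    (hl : {q, r, p} ∈ G.lines) (h : IsUp R a p {q, r, p}) :
    ∃ b c, Triad a b c ∧ R q b ∧ R r c := by
  obtain ⟨b, c, s, t, h, hs, ht, he⟩ := h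
  have hm := hR.mem_line h hp hs ht
  have hn := ne_of_mem_lines hl
  have hn' := ne_of_mem_lines hm
  have hs' : s = q ∨ s = r ∨ s = p := by
    have : s ∈ ({q, r, p} : Set P) := by simp [he]
    simpa using this
  have ht' : t = q ∨ t = r ∨ t = p := by
    have : t ∈ ({q, r, p} : Set P) := by simp [he]
    simpa using this
  rcases hs' with rfl | rfl | rfl
  · rcases ht' with rfl | rfl | rfl
    · exact absurd rfl hn'.2.2
    · exact ⟨b, c, h, hs, ht⟩
    · exact absurd rfl hn'.2.1
  · rcases ht' with rfl | rfl | rfl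
    · exact ⟨c, b, h.rot.rot.swap, ht, hs⟩
    · exact absurd rfl hn'.2.2
    · exact absurd rfl hn'.2.1
  · exact absurd rfl hn'.1

theorem IsUp.exists_isQuad (hR : IsCoordinatization G.toPointLineGeometry R) (hp : R p a)
    (h : IsUp R a p l) (h' : IsUp R aᶜ p m) :
    ∃ q r s t y z, G.IsQuad q r s t p y z ∧ l = {q, r, p} ∧ m = {s, t, p} := by
  obtain ⟨b, c, q, r, h, hq, hr, rfl⟩ := h
  obtain ⟨b', c', s, t, h', hs, ht, rfl⟩ := h'
  obtain ⟨y, z, hz⟩ := hR.exists_isQuad h.rot h'.rot hq hr hs ht hp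
  exact ⟨q, r, s, t, y, z, hz, by rw [Set.insert_comm, Set.pair_comm],
    by rw [Set.insert_comm, Set.pair_comm]⟩

/-- Since b and d are the remainders of a and c in uᶜ, a ≤ c gives d ≤ b. Of the four ways b and c
can be comparable, b ≤ cᶜ gives b ≤ d, and the others force a nonzero element to be ⊥. -/
theorem eq_of_le_of_collinear (hR : IsCoordinatization G.toPointLineGeometry R) (h : Triad u a b)
    (h' : Triad u c d) (hac : a ≤ c) (hq : R q b) (hr : R r c) (hs : R s d)
    (hqr : G.Collinear q r) (hne : q ≠ r) : q = s := by
  have hd : d ≤ b := h.le_of_le (le_compl_comm.1 h'.left_le)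
    ((le_compl_comm.1 h'.mid_le).trans (compl_le_compl.2 hac))
  rcases hR.comparable hqr hne hq hr with h1 | h1 | h1 | h1
  · have hb : b ≤ d := h'.le_of_le (le_compl_comm.1 h.left_le) h1
    exact hR.point_unique hq (le_antisymm hb hd ▸ hs)
  · exact absurd (eq_bot_of_le (hd.trans h1) (le_compl_comm.1 h'.mid_le)) h'.right_ne
  · exact absurd (eq_bot_of_le (hac.trans h1) h.mid_le) h.mid_ne
  · exact absurd (eq_bot_of_le (h.left_le.trans h1) h'.orth) h.left_ne

/-- If u were an atom of both lines, the vertices p, r would carry comparable elements of the two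
triads. By `eq_of_le_of_collinear` and the sides of the quad, two distinct vertices would then
coincide. -/
theorem not_isUp_of_isQuad (hR : IsCoordinatization G.toPointLineGeometry R) (hx : R x u)
    {y z : P} (hQ : G.IsQuad p q r s x y z) (h : IsUp R u x {p, q, x}) :
    ¬ IsUp R u x {r, s, x} := by
  intro h'
  obtain ⟨a, b, h, hp, hq⟩ := h.exists_triad hR hx hQ.abx
  obtain ⟨c, d, h', hr, hs⟩ := h'.exists_triad hR hx hQ.cdx
  have n1 := ne_of_mem_lines hQ.acy
  have n2 := ne_of_mem_lines hQ.bcz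
  have n3 := ne_of_mem_lines hQ.bdy
  have n4 := ne_of_mem_lines hQ.adz
  have c1 : G.Collinear p r := ⟨_, hQ.acy, by simp, by simp⟩
  have c2 : G.Collinear q r := ⟨_, hQ.bcz, by simp, by simp⟩
  have c3 : G.Collinear q s := ⟨_, hQ.bdy, by simp, by simp⟩
  have c4 : G.Collinear s p := ⟨_, hQ.adz, by simp, by simp⟩
  rcases hR.comparable c1 n1.1 hp hr with h1 | h1 | h1 | h1
  · have had : a ≤ d := h'.le_of_le (le_compl_comm.1 h.orth) h1
    exact n2.1 (hR.eq_of_le_of_collinear h h'.rot.rot.swap had hq hs hr c3 n3.1)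
  · exact n3.1 (hR.eq_of_le_of_collinear h h' h1 hq hr hs c2 n2.1)
  · exact n3.1 (hR.eq_of_le_of_collinear h' h h1 hs hp hq c4 n4.1.symm).symm
  · exact h.left_ne (eq_bot_of_le (h.orth.trans h1) h'.orth)

open Classical in
theorem nonempty_direction (hR : IsCoordinatization G.toPointLineGeometry R) (p : P) :
    Nonempty (G.Direction p) := by
  obtain ⟨a, hp⟩ := hR.exists_rel p
  have hp' := hR.rel_compl hp
  -- A line that is not up for a is up for aᶜ, so the two values can be treated symmetrically.
  refine ⟨fun l => if IsUp R a p l.1 then .up else .down, ?_⟩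
  rintro ⟨l, hl, hpl⟩ ⟨m, hm, hpm⟩
  rw [exists_isPlane_iff_exists_isQuad hl hm hpl]
  have hl' := hR.isUp_or hp hl hpl
  have hm' := hR.isUp_or hp hm hpm
  constructor
  · intro h
    by_cases h1 : IsUp R a p l <;> by_cases h2 : IsUp R a p m
    · simp [h1, h2] at h
    · exact h1.exists_isQuad hR hp (hm'.resolve_left h2)
    · exact (hl'.resolve_left h1).exists_isQuad hR hp' ((compl_compl a).symm ▸ h2)
    · simp [h1, h2] at h
  · rintro ⟨q, r, s, t, y, z, hQ, rfl, rfl⟩ h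
    by_cases h1 : IsUp R a p {q, r, p} <;> by_cases h2 : IsUp R a p {s, t, p}
    · exact hR.not_isUp_of_isQuad hp hQ h1 h2
    · simp [h1, h2] at h
    · simp [h1, h2] at h
    · exact hR.not_isUp_of_isQuad hp' hQ (hl'.resolve_left h1) (hm'.resolve_left h2)

end IsCoordinatization

end OrthomodularPoset

/-! ### Sufficiency: signs on flags and their behaviour in planes. -/

namespace PreOrthogeometry

variable {P : Type u} {G : PreOrthogeometry P} {δ : P → Set P → Bool}
  {a b c d x y z p q r s : P} {l m n : Set P}

/-- A choice of signs for all flags that is a direction at every point, with the planes of the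
definition of a direction replaced by quads. -/
def IsSigning (G : PreOrthogeometry P) (δ : P → Set P → Bool) : Prop :=
  ∀ ⦃p l m⦄, l ∈ G.lines → m ∈ G.lines → p ∈ l → p ∈ m →
    (δ p l ≠ δ p m ↔ ∃ a b c d y z, G.IsQuad a b c d p y z ∧ l = {a, b, p} ∧ m = {c, d, p})

open Classical in
theorem exists_isSigning (h : ∀ p, Nonempty (G.Direction p)) : ∃ δ, G.IsSigning δ := by
  let D := fun p => Classical.choice (h p)
  -- The value off flags is arbitrary, as `IsSigning` only inspects flags.
  refine ⟨fun p l => if h : l ∈ G.lines ∧ p ∈ l then decide ((D p).arrow ⟨l, h⟩ = .up) else false,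
    fun p l m hl hm hpl hpm => ?_⟩
  beta_reduce
  rw [← exists_isPlane_iff_exists_isQuad hl hm hpl,
    ← (D p).opposite_iff ⟨l, hl, hpl⟩ ⟨m, hm, hpm⟩, dif_pos ⟨hl, hpl⟩, dif_pos ⟨hm, hpm⟩]
  cases (D p).arrow ⟨l, hl, hpl⟩ <;> cases (D p).arrow ⟨m, hm, hpm⟩ <;> simp

namespace IsSigning

theorem ne_midpoint (hδ : G.IsSigning δ) (h : G.IsQuad a b c d x y z) :
    δ x {a, b, x} ≠ δ x {c, d, x} :=
  (hδ h.abx h.cdx (by simp) (by simp)).2 ⟨_, _, _, _, _, _, h, rfl, rfl⟩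

/-- Opposite signs would give a second plane with a as midpoint, containing b and c and hence z. The
line adz would then be a third line through a midpoint in that plane. -/
theorem eq_vertex (hδ : G.IsSigning δ) (h : G.IsQuad a b c d x y z) :
    δ a {a, b, x} = δ a {a, c, y} := by
  by_contra hne
  obtain ⟨a', b', c', d', y', z', h', h1, h2⟩ := (hδ h.abx h.acy (by simp) (by simp)).1 hne
  have hb : b ∈ quadSet a' b' c' d' a y' z' := by
    have : b ∈ ({a', b', a} : Set P) := by simp [← h1]
    rw [mem_quadSet]
    clear h h'
    grind
  have hc : c ∈ quadSet a' b' c' d' a y' z' := by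
    have : c ∈ ({c', d', a} : Set P) := by simp [← h2]
    rw [mem_quadSet]
    clear h h'
    grind
  have hbcz := ne_of_mem_lines h.bcz
  have hz : z ∈ quadSet a' b' c' d' a y' z' :=
    h'.isSubspace _ h.bcz ⟨b, ⟨by simp, hb⟩, c, ⟨by simp, hc⟩, hbcz.1⟩ (by simp)
  have hn := h.nodup
  rcases h'.lines_through_midpoint h.adz (by simp) (p := z) (by simp) hz
    (ne_of_mem_lines h.adz).2.1.symm with h3 | h3
  · have : b ∈ ({a, d, z} : Set P) := by simp [h3, ← h1]
    clear h h'
    grind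
  · have : c ∈ ({a, d, z} : Set P) := by simp [h3, ← h2]
    clear h h'
    grind

/-- A midpoint lies on only two lines of the plane, and these have opposite signs there. -/
theorem mem_vertices (hδ : G.IsSigning δ) (h : G.IsQuad a b c d x y z)
    (hp : p ∈ quadSet a b c d x y z) (hq : q ∈ quadSet a b c d x y z)
    (hr : r ∈ quadSet a b c d x y z) (hl : l ∈ G.lines) (hm : m ∈ G.lines) (hpl : p ∈ l)
    (hql : q ∈ l) (hpm : p ∈ m) (hrm : r ∈ m) (hqp : q ≠ p) (hrp : r ≠ p) (hlm : l ≠ m)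
    (he : δ p l = δ p m) : p = a ∨ p = b ∨ p = c ∨ p = d := by
  have key : ∀ {a b c d y z}, G.IsQuad a b c d p y z → q ∈ quadSet a b c d p y z →
      r ∈ quadSet a b c d p y z → False := by
    intro a b c d y z h hq hr
    have hne := hδ.ne_midpoint h
    rcases h.lines_through_midpoint hl hpl hql hq hqp with rfl | rfl <;>
      rcases h.lines_through_midpoint hm hpm hrm hr hrp with rfl | rfl
    exacts [hlm rfl, hne he, hne he.symm, hlm rfl]
  rcases mem_quadSet.1 hp with hp | hp | hp | hp | rfl | rfl | rfl
  · exact Or.inl hp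
  · exact Or.inr (Or.inl hp)
  · exact Or.inr (Or.inr (Or.inl hp))
  · exact Or.inr (Or.inr (Or.inr hp))
  · exact (key h hq hr).elim
  · exact (key h.swap_bc (quadSet_swap_bc ▸ hq) (quadSet_swap_bc ▸ hr)).elim
  · rw [← quadSet_swap_cd, ← quadSet_swap_bc] at hq hr
    exact (key h.swap_cd.swap_bc hq hr).elim

theorem exists_line_of_midpoint (hδ : G.IsSigning δ) (h : G.IsQuad a b c d x y z) :
    ∃ k ∈ G.lines, a ∈ k ∧ c ∈ k ∧ a ≠ c ∧ δ a k = δ a {a, b, x} ∧ δ c k = δ c {c, d, x} := by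
  refine ⟨_, h.acy, by simp, by simp, (ne_of_mem_lines h.acy).1, (hδ.eq_vertex h).symm, ?_⟩
  rw [hδ.eq_vertex h.swap_sides, Set.insert_comm]

/-- This is transitivity of the order to come. Opposite signs at q make it a midpoint of a plane
with p and r as vertices on its two lines; the line pr belongs to the plane, and `eq_vertex`
transfers the signs. -/
theorem exists_line_trans (hδ : G.IsSigning δ) (hl : l ∈ G.lines) (hm : m ∈ G.lines) (hpl : p ∈ l)
    (hql : q ∈ l) (hqm : q ∈ m) (hrm : r ∈ m) (hpq : p ≠ q) (hqr : q ≠ r)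
    (hne : δ q l ≠ δ q m) :
    ∃ k ∈ G.lines, p ∈ k ∧ r ∈ k ∧ p ≠ r ∧ δ p k = δ p l ∧ δ r k = δ r m := by
  obtain ⟨a, b, c, d, y, z, h, rfl, rfl⟩ := (hδ hl hm hql hqm).1 hne
  rcases hpl with rfl | rfl | hpl
  · rcases hrm with rfl | rfl | hrm
    · exact hδ.exists_line_of_midpoint h
    · rw [Set.insert_comm c]
      exact hδ.exists_line_of_midpoint h.swap_cd
    · exact absurd hrm.symm hqr
  · rw [Set.insert_comm a]
    rcases hrm with rfl | rfl | hrm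
    · exact hδ.exists_line_of_midpoint h.swap_ab
    · rw [Set.insert_comm c]
      exact hδ.exists_line_of_midpoint h.swap_ab.swap_cd
    · exact absurd hrm.symm hqr
  · exact absurd hpl hpq

end IsSigning

theorem IsQuad.exists_of_vertices (h : G.IsQuad a b c d x y z)
    (hp : p = a ∨ p = b ∨ p = c ∨ p = d) (hq : q = a ∨ q = b ∨ q = c ∨ q = d)
    (hs : s = a ∨ s = b ∨ s = c ∨ s = d) (hpq : p ≠ q) (hps : p ≠ s) (hqs : q ≠ s) :
    ∃ d' x' y' z', G.IsQuad p q s d' x' y' z' := by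
  have step1 : ∃ b' c' d' x' y' z', G.IsQuad p b' c' d' x' y' z' ∧
      (q = b' ∨ q = c' ∨ q = d') ∧ (s = b' ∨ s = c' ∨ s = d') := by
    rcases hp with rfl | rfl | rfl | rfl
    · exact ⟨_, _, _, _, _, _, h, by grind only, by grind only⟩
    · exact ⟨_, _, _, _, _, _, h.swap_ab, by grind only, by grind only⟩
    · exact ⟨_, _, _, _, _, _, h.swap_bc.swap_ab, by grind only, by grind only⟩
    · exact ⟨_, _, _, _, _, _, h.swap_cd.swap_bc.swap_ab, by grind only, by grind only⟩
  obtain ⟨b', c', d', x', y', z', h', hq', hs'⟩ := step1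
  have step2 : ∃ c' d' x' y' z', G.IsQuad p q c' d' x' y' z' ∧ (s = c' ∨ s = d') := by
    rcases hq' with rfl | rfl | rfl
    · exact ⟨_, _, _, _, _, h', by grind only⟩
    · exact ⟨_, _, _, _, _, h'.swap_bc, by grind only⟩
    · exact ⟨_, _, _, _, _, h'.swap_cd.swap_bc, by grind only⟩
  obtain ⟨c', d', x', y', z', h', rfl | rfl⟩ := step2
  · exact ⟨_, _, _, _, h'⟩
  · exact ⟨_, _, _, _, h'.swap_cd⟩

/-- Every non-degenerate triangle is contained in a plane. -/
def TrianglesInPlanes (G : PreOrthogeometry P) : Prop :=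
  ∀ p q r, G.IsNondegenerateTriangle p q r → ∃ w, G.IsPlane w ∧ p ∈ w ∧ q ∈ w ∧ r ∈ w

/-- Geometric form of the statement that a common upper bound at s of the atoms at p and q lies
above their join at r. If s is off the line, the signs agree at every corner of the triangle pqs, so
its corners are vertices of a plane, r is the midpoint of pq, and the required line is the one
through r and s. -/
theorem IsSigning.exists_line_join (hδ : G.IsSigning δ) (hT : G.TrianglesInPlanes)
    (hl : {p, q, r} ∈ G.lines) (hm : m ∈ G.lines) (hn : n ∈ G.lines) (hpm : p ∈ m) (hsm : s ∈ m)
    (hps : p ≠ s) (hqn : q ∈ n) (hsn : s ∈ n) (hqs : q ≠ s) (hp : δ p m = δ p {p, q, r})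
    (hq : δ q n = δ q {p, q, r}) (he : δ s m = δ s n) :
    (r = s ∧ m = {p, q, r}) ∨
      ∃ k ∈ G.lines, r ∈ k ∧ s ∈ k ∧ r ≠ s ∧ δ r k ≠ δ r {p, q, r} ∧ δ s k = δ s m := by
  have hne := ne_of_mem_lines hl
  by_cases hs : s ∈ ({p, q, r} : Set P)
  · left
    have hrs : r = s := by
      rcases hs with h | h | h
      exacts [absurd h.symm hps, absurd h.symm hqs, h.symm]
    exact ⟨hrs, eq_of_mem hm hl hps hpm hsm (by simp) hs⟩
  right
  have hml : m ≠ {p, q, r} := fun h => hs (h ▸ hsm)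
  have hnl : n ≠ {p, q, r} := fun h => hs (h ▸ hsn)
  have hmn : m ≠ n := fun h => hml (eq_of_mem hm hl hne.1 hpm (h ▸ hqn) (by simp) (by simp))
  obtain ⟨w, hw, hpw, hqw, hsw⟩ := hT p q s ⟨hne.1, hps, hqs, ⟨_, hl, by simp, by simp⟩,
    ⟨m, hm, hpm, hsm⟩, ⟨n, hn, hqn, hsn⟩, fun ⟨k, hk, h1, h2, h3⟩ =>
      hs (eq_of_mem hk hl hne.1 h1 h2 (by simp) (by simp) ▸ h3)⟩
  obtain ⟨a, b, c, d, x, y, z, h, rfl⟩ := hw.exists_isQuad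
  obtain ⟨d', x', y', z', h'⟩ := h.exists_of_vertices
    (hδ.mem_vertices h hpw hqw hsw hl hm (by simp) (by simp) hpm hsm hne.1.symm hps.symm hml.symm
      hp.symm)
    (hδ.mem_vertices h hqw hpw hsw hl hn (by simp) (by simp) hqn hsn hne.1 hqs.symm hnl.symm
      hq.symm)
    (hδ.mem_vertices h hsw hpw hqw hm hn hsm hpm hsn hqn hps hqs hmn he) hne.1 hps hqs
  have hlx := eq_of_mem hl h'.abx hne.1 (by simp) (by simp) (by simp) (by simp)
  have hxr : r = x' := by
    have : r ∈ ({p, q, x'} : Set P) := by simp [← hlx]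
    rcases this with h0 | h0 | h0
    exacts [absurd h0.symm hne.2.1, absurd h0.symm hne.2.2, h0]
  subst hxr
  refine ⟨_, h'.cdx, by simp, by simp, (ne_of_mem_lines h'.cdx).2.1.symm,
    (hδ.ne_midpoint h').symm, ?_⟩
  rw [hδ.eq_vertex h'.swap_sides,
    eq_of_mem hm h'.swap_sides.acy hps hpm hsm (by simp) (by simp)]

/-- The elements of the orthomodular poset of a geometry with signs: two elements for every point,
together with the bounds. -/
inductive SignedPoint (G : PreOrthogeometry P) (δ : P → Set P → Bool) : Type u
  | bot
  | top
  | pt (p : P) (s : Bool)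

/-! ### The orthomodular poset of signed points. -/

namespace SignedPoint

/-- The copy of p with sign `δ p l` plays the role of an atom of l. Distinct atoms of l are to be
orthogonal, so the atom at p lies below the complement of the atom at q; this explains the negation
of t. -/
instance : LE (SignedPoint G δ) where
  le
    | bot, _ => True
    | _, top => True
    | pt p s, pt q t => (p = q ∧ s = t) ∨
        ∃ l ∈ G.lines, p ∈ l ∧ q ∈ l ∧ p ≠ q ∧ δ p l = s ∧ δ q l = !t
    | _, _ => False

instance : Bot (SignedPoint G δ) := ⟨bot⟩

instance : Top (SignedPoint G δ) := ⟨top⟩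

instance : Compl (SignedPoint G δ) where
  compl
    | bot => top
    | top => bot
    | pt p s => pt p !s

variable {e f g : SignedPoint G δ} {i j k : Bool}

theorem bot_le (e : SignedPoint G δ) : bot ≤ e := by cases e <;> trivial

theorem le_top (e : SignedPoint G δ) : e ≤ top := by cases e <;> trivial

theorem le_bot (h : e ≤ bot) : e = bot := by
  cases e
  exacts [rfl, h.elim, h.elim]

theorem top_le (h : top ≤ e) : e = top := by
  cases e
  exacts [h.elim, rfl, h.elim]

theorem pt_le_pt : (pt p i : SignedPoint G δ) ≤ pt q j ↔ (p = q ∧ i = j) ∨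
    ∃ l ∈ G.lines, p ∈ l ∧ q ∈ l ∧ p ≠ q ∧ δ p l = i ∧ δ q l = !j := Iff.rfl

theorem le_rfl' (e : SignedPoint G δ) : e ≤ e := by
  cases e
  exacts [trivial, trivial, Or.inl ⟨rfl, rfl⟩]

theorem antisymm (h : e ≤ f) (h' : f ≤ e) : e = f := by
  cases e with
  | bot => exact (le_bot h').symm
  | top => exact (top_le h).symm
  | pt p i =>
    cases f with
    | bot => exact le_bot h
    | top => exact top_le h'
    | pt q j =>
      rcases pt_le_pt.1 h with ⟨rfl, rfl⟩ | ⟨l, hl, hp, hq, hne, h1, h2⟩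
      · rfl
      rcases pt_le_pt.1 h' with ⟨rfl, rfl⟩ | ⟨m, hm, hq', hp', -, h3, h4⟩
      · rfl
      obtain rfl := eq_of_mem hl hm hne hp hq hp' hq'
      simp_all

theorem trans (hδ : G.IsSigning δ) (h : e ≤ f) (h' : f ≤ g) : e ≤ g := by
  cases e with
  | bot => exact bot_le g
  | top => rwa [top_le h] at h'
  | pt p i =>
    cases f with
    | bot => exact (nomatch le_bot h)
    | top => rw [top_le h']; exact le_top _
    | pt q j =>
      cases g with
      | bot => exact (nomatch le_bot h')
      | top => exact le_top _
      | pt r k =>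
        rcases pt_le_pt.1 h with ⟨rfl, rfl⟩ | ⟨l, hl, hp, hq, hne, h1, h2⟩
        · exact h'
        rcases pt_le_pt.1 h' with ⟨rfl, rfl⟩ | ⟨m, hm, hq', hr, hne', h3, h4⟩
        · exact h
        obtain ⟨n, hn, hp', hr', hpr, h5, h6⟩ :=
          hδ.exists_line_trans hl hm hp hq hq' hr hne hne' (by rw [h2, h3]; simp)
        exact Or.inr ⟨n, hn, hp', hr', hpr, h5.trans h1, h6.trans h4⟩

theorem compl_compl (e : SignedPoint G δ) : eᶜᶜ = e := by
  cases e with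
  | bot => rfl
  | top => rfl
  | pt p i => exact congrArg (pt p) (Bool.not_not i)

theorem compl_anti (h : e ≤ f) : fᶜ ≤ eᶜ := by
  cases e with
  | bot => exact le_top _
  | top => rw [top_le h]; exact bot_le _
  | pt p i =>
    cases f with
    | bot => exact (nomatch le_bot h)
    | top => exact bot_le _
    | pt q j =>
      rcases pt_le_pt.1 h with ⟨rfl, rfl⟩ | ⟨l, hl, hp, hq, hne, h1, h2⟩
      · exact le_rfl' _
      · exact Or.inr ⟨l, hl, hq, hp, hne.symm, h2, by simpa using h1⟩

/-- The line joining two distinct points is unique and carries only one sign at p, so only one of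
the two copies of p can lie below a given copy of q. -/
theorem eq_top_of_compl_le (h : e ≤ f) (h' : eᶜ ≤ f) : f = top := by
  cases e with
  | bot => exact top_le h'
  | top => exact top_le h
  | pt p i =>
    cases f with
    | bot => exact (nomatch le_bot h)
    | top => rfl
    | pt q j =>
      rcases pt_le_pt.1 h with ⟨rfl, rfl⟩ | ⟨l, hl, hp, hq, hne, h1, h2⟩ <;>
        rcases pt_le_pt.1 h' with ⟨h5, h6⟩ | ⟨m, hm, hp', hq', hne', h3, h4⟩
      · simp at h6
      · exact absurd rfl hne'
      · exact absurd h5 hne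
      · obtain rfl := eq_of_mem hl hm hne hp hq hp' hq'
        simp [h1] at h3

theorem isLUB_compl (e : SignedPoint G δ) : IsLUB {e, eᶜ} top :=
  ⟨fun _ _ => le_top _, fun f hf => by
    rw [eq_top_of_compl_le (hf (Set.mem_insert _ _)) (hf (Set.mem_insert_of_mem _ rfl))]
    exact le_rfl' _⟩

theorem isLUB_of_le (h : e ≤ f) : IsLUB {e, f} f :=
  ⟨by rintro _ (rfl | rfl); exacts [h, le_rfl' _], fun _ hg => hg (Set.mem_insert_of_mem _ rfl)⟩

theorem isLUB_line (hδ : G.IsSigning δ) (hT : G.TrianglesInPlanes) (hl : {p, q, r} ∈ G.lines) :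
    IsLUB {(pt p (δ p {p, q, r}) : SignedPoint G δ), pt q (δ q {p, q, r})}
      (pt r !(δ r {p, q, r})) := by
  have hne := ne_of_mem_lines hl
  constructor
  · rintro _ (rfl | rfl)
    · exact Or.inr ⟨_, hl, by simp, by simp, hne.2.1, rfl, by simp⟩
    · exact Or.inr ⟨_, hl, by simp, by simp, hne.2.2, rfl, by simp⟩
  · intro e he
    have h1 := he (Set.mem_insert _ _)
    have h2 := he (Set.mem_insert_of_mem _ rfl)
    cases e with
    | bot => exact (nomatch le_bot h1)
    | top => exact le_top _
    | pt s j =>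
      rcases pt_le_pt.1 h1 with ⟨rfl, h3⟩ | ⟨m, hm, hpm, hsm, hps, h3, h4⟩
      · exfalso
        rcases pt_le_pt.1 h2 with ⟨h, -⟩ | ⟨m, hm, hpm, hsm, hps, h5, h6⟩
        · exact hne.1 h.symm
        · obtain rfl := eq_of_mem hm hl hne.1 hsm hpm (by simp) (by simp)
          simp [h3] at h6
      · rcases pt_le_pt.1 h2 with ⟨rfl, h5⟩ | ⟨n, hn, hqn, hsn, hqs, h5, h6⟩
        · exfalso
          obtain rfl := eq_of_mem hm hl hne.1 hpm hsm (by simp) (by simp)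
          simp [h5] at h4
        · rcases hδ.exists_line_join hT hl hm hn hpm hsm hps hqn hsn hqs h3 h5
            (h4.trans h6.symm) with ⟨rfl, rfl⟩ | ⟨k, hk, hrk, hsk, hrs, h7, h8⟩
          · exact Or.inl ⟨rfl, by simp [h4]⟩
          · exact Or.inr ⟨k, hk, hrk, hsk, hrs, Bool.eq_not.2 h7, h8.trans h4⟩

theorem isLUB_unique (he : IsLUB {e, f} g) {g' : SignedPoint G δ} (he' : IsLUB {e, f} g') :
    g = g' :=
  antisymm (he.2 he'.1) (he'.2 he.1)

/-- De Morgan: the meet in the orthomodular law is reduced to a join, which `isLUB_line` computes.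
-/
theorem isLUB_of_isGLB (h : IsGLB {f, eᶜ} g) : IsLUB {e, fᶜ} gᶜ := by
  constructor
  · rintro _ (rfl | rfl)
    · have := compl_anti (h.1 (Set.mem_insert_of_mem _ rfl))
      rwa [compl_compl] at this
    · exact compl_anti (h.1 (Set.mem_insert _ _))
  · intro y hy
    have : yᶜ ≤ g := h.2 (by
      rintro _ (rfl | rfl)
      · have := compl_anti (hy (Set.mem_insert_of_mem _ rfl))
        rwa [compl_compl] at this
      · exact compl_anti (hy (Set.mem_insert _ _)))
    have := compl_anti this
    rwa [compl_compl] at this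

theorem exists_isLUB (hδ : G.IsSigning δ) (hT : G.TrianglesInPlanes) (h : e ≤ fᶜ) :
    ∃ g, IsLUB {e, f} g := by
  cases e with
  | bot => exact ⟨f, isLUB_of_le (bot_le f)⟩
  | top => exact ⟨top, by rw [Set.pair_comm]; exact isLUB_of_le (le_top _)⟩
  | pt p i =>
    cases f with
    | bot => exact ⟨pt p i, by rw [Set.pair_comm]; exact isLUB_of_le (bot_le _)⟩
    | top => exact ⟨top, isLUB_of_le (le_top _)⟩
    | pt q j =>
      rcases pt_le_pt.1 h with ⟨rfl, rfl⟩ | ⟨l, hl, hp, hq, hne, rfl, h2⟩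
      · exact ⟨top, by rw [Set.pair_comm]; exact isLUB_compl _⟩
      · obtain ⟨r, rfl⟩ := exists_eq_of_mem_lines hl hp hq hne
        rw [Bool.not_not] at h2
        subst h2
        exact ⟨_, isLUB_line hδ hT hl⟩

theorem orthomodular (hδ : G.IsSigning δ) (hT : G.TrianglesInPlanes) (h : e ≤ f)
    (hg : IsGLB {f, eᶜ} g) : IsLUB {e, g} f := by
  have hg' := isLUB_of_isGLB hg
  cases e with
  | bot =>
    have := isLUB_unique hg' (isLUB_of_le (bot_le _))
    rw [← compl_compl g, this, compl_compl]
    exact isLUB_of_le (bot_le f)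
  | top =>
    rw [top_le h, Set.pair_comm]
    exact isLUB_of_le (le_top _)
  | pt p i =>
    cases f with
    | bot => exact (nomatch le_bot h)
    | top =>
      have := isLUB_unique hg' (by rw [Set.pair_comm]; exact isLUB_of_le (bot_le _))
      rw [← compl_compl g, this]
      exact isLUB_compl _
    | pt q j =>
      rcases pt_le_pt.1 h with ⟨rfl, rfl⟩ | ⟨l, hl, hp, hq, hne, rfl, h2⟩
      · have := isLUB_unique hg' (isLUB_compl _)
        rw [← compl_compl g, this, Set.pair_comm]
        exact isLUB_of_le (bot_le _)
      · obtain ⟨r, rfl⟩ := exists_eq_of_mem_lines hl hp hq hne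
        have hj : (!j) = δ q {p, q, r} := h2.symm
        -- Here fᶜ is the atom at q, so gᶜ is the join of the atoms at p and q, and g is the atom at
        -- r. The claim e ∨ g = f is then the same line join with q and r exchanged.
        have hg2 : IsLUB {(pt p (δ p {p, q, r}) : SignedPoint G δ), pt q (δ q {p, q, r})} gᶜ := by
          rw [← hj]
          exact hg'
        have := isLUB_unique hg2 (isLUB_line hδ hT hl)
        have hgr : g = pt r (δ r {p, q, r}) := by
          rw [← compl_compl g, this]
          exact congrArg (pt r) (Bool.not_not _)
        have hj' : j = !(δ q {p, q, r}) := by rw [← hj, Bool.not_not]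
        rw [hgr, hj']
        rw [Set.pair_comm q r] at hl ⊢
        exact isLUB_line hδ hT hl

/-- The order on the elements of the orthomodular poset of a geometry with signs. -/
abbrev partialOrder (hδ : G.IsSigning δ) : PartialOrder (SignedPoint G δ) where
  le_refl := le_rfl'
  le_trans _ _ _ := trans hδ
  le_antisymm _ _ := antisymm

instance : BoundedOrder (SignedPoint G δ) where
  bot_le := bot_le
  le_top := le_top

/-- The orthomodular poset of a geometry with signs. -/
abbrev orthomodularPoset (hδ : G.IsSigning δ) (hT : G.TrianglesInPlanes) :
    OrthomodularPoset (SignedPoint G δ) where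
  __ := partialOrder hδ
  __ := (inferInstance : BoundedOrder (SignedPoint G δ))
  compl_compl' := compl_compl
  compl_anti' _ _ := compl_anti
  isCompl_compl' e := by
    let _ := partialOrder hδ
    refine ⟨fun f h h' => ?_, fun f h h' => ?_⟩
    · have h1 := compl_anti h'
      have h2 := eq_top_of_compl_le (compl_anti h) h1
      have : f = bot := by rw [← compl_compl f, h2]; rfl
      exact this ▸ le_rfl' _
    · rw [eq_top_of_compl_le h h']
      exact le_rfl' _
  exists_isLUB' _ _ := exists_isLUB hδ hT
  orthomodular' _ _ _ := orthomodular hδ hT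

open OrthomodularPoset in
theorem isCoordinatization (hδ : G.IsSigning δ) (hT : G.TrianglesInPlanes) :
    letI := orthomodularPoset hδ hT
    IsCoordinatization G.toPointLineGeometry
      (fun p (e : SignedPoint G δ) => ∃ i, e = pt p i) := by
  let _ := orthomodularPoset hδ hT
  refine ⟨fun p => ⟨_, true, rfl⟩, ?_, ?_, ?_, ?_, ?_, ?_⟩
  · rintro p e ⟨i, rfl⟩ h
    exact nomatch (h : pt p i = bot)
  · rintro p e ⟨i, rfl⟩ h
    exact nomatch (h : pt p i = top)
  · intro e he he'
    cases e with
    | bot => exact absurd rfl he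
    | top => exact absurd rfl he'
    | pt p i => exact ⟨p, i, rfl⟩
  · rintro p e f ⟨i, rfl⟩
    constructor
    · rintro ⟨j, rfl⟩
      by_cases hij : j = i
      · exact Or.inl (by rw [hij])
      · exact Or.inr (by rw [Bool.eq_not.2 hij]; rfl)
    · rintro (rfl | rfl)
      exacts [⟨_, rfl⟩, ⟨_, rfl⟩]
  · rintro p q e ⟨i, rfl⟩ ⟨j, h⟩
    injection h
  · intro l
    constructor
    · intro hl
      obtain ⟨p, q, r, hpq, -, -, rfl⟩ := Set.ncard_eq_three.1 (G.ncard_line l hl)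
      refine ⟨pt p (δ p {p, q, r}), pt q (δ q {p, q, r}), pt r (δ r {p, q, r}), p, q, r,
        ⟨(fun h => nomatch h), (fun h => nomatch h), (fun h => nomatch h), ?_,
          isLUB_line hδ hT hl⟩,
        ⟨_, rfl⟩, ⟨_, rfl⟩, ⟨_, rfl⟩, rfl⟩
      exact Or.inr ⟨_, hl, by simp, by simp, hpq, rfl, by simp⟩
    · rintro ⟨_, _, _, p, q, r, h, ⟨i, rfl⟩, ⟨j, rfl⟩, ⟨k, rfl⟩, rfl⟩
      rcases pt_le_pt.1 h.orth with ⟨rfl, rfl⟩ | ⟨l, hl, hp, hq, hne, rfl, h2⟩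
      -- Two complementary copies of one point have join ⊤, which is not the complement of a signed
      -- point.
      · have h3 : IsLUB {(pt p (!j) : SignedPoint G δ), pt p j} (pt r k)ᶜ := h.lub
        rw [Set.pair_comm] at h3
        exact nomatch isLUB_unique h3 (isLUB_compl _)
      · obtain ⟨s, rfl⟩ := exists_eq_of_mem_lines hl hp hq hne
        rw [Bool.not_not] at h2
        subst h2
        have h3 := isLUB_unique h.lub (isLUB_line hδ hT hl)
        injection h3 with h3
        rwa [h3]

end SignedPoint

end PreOrthogeometry

theorem mainTheorem4 {P : Type u} (G : PreOrthogeometry P) (hG : G.IsProper) :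
    G.IsOrthogeometry ↔
      ((∀ p q r : P, G.IsNondegenerateTriangle p q r →
          ∃ w : Set P, G.IsPlane w ∧ p ∈ w ∧ q ∈ w ∧ r ∈ w) ∧
        ∀ p : P, Nonempty (G.Direction p)) := by
  rw [G.isOrthogeometry_iff]
  constructor
  · rintro ⟨A, _, R, hR⟩
    exact ⟨fun p q r h => hR.exists_isPlane_of_triangle h, hR.nonempty_direction⟩
  · rintro ⟨hT, hD⟩
    obtain ⟨δ, hδ⟩ := PreOrthogeometry.exists_isSigning hD
    exact ⟨_, _, _, PreOrthogeometry.SignedPoint.isCoordinatization hδ hT⟩
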